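/- Let $\Lambda=(\mathcal V,\mathcal E)$ be a finite undirected graph with maximal degree $\kappa\ge 2$, and let $\beta>0$, $\vartheta>0$. Let $\rho$ be the law of independent Poisson point processes of unit intensity on $[0,\beta]$, one for each edge of $\Lambda$; the points $(e,t)$ of a realization $\omega$ are called bridges. A *cycle* of $\omega$ is a closed trajectory on the cylinder $\mathcal V\times[0,\beta]_{\rm per}$ (time is periodic) that moves along the time direction with velocity $+1$ and that, whenever it arrives at a vertex $x$ at a time $t$ for which there is a bridge $(\{x,y\},t)$, jumps to $y$. If $\Lambda$ is bipartite with $\mathcal V=\mathcal V_{\rm A}\cup\mathcal V_{\rm B}$, a *loop* of $\omega$ is defined in the same way, except that the velocity is $+1$ at vertices of $\mathcal V_{\rm A}$ and $-1$ at vertices of $\mathcal V_{\rm B}$. The length of a cycle or loop is the smallest positive time after which it returns to its starting point. Trajectories with the same support are identified; $|\mathcal C(\omega)|$ and $|\mathcal L(\omega)|$ denote the numbers of cycles and of loops, and $L(\gamma_x)$ denotes the length of the cycle, respectively loop, that contains $(x,0)$. Consider the probability measures $$\mathbb P^{\rm cycles}({\rm d}\omega)=\frac{1}{Z^{\rm cycles}}\,\vartheta^{|\mathcal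 C(\omega)|}\rho({\rm d}\omega),\qquad \mathbb P^{\rm loops}({\rm d}\omega)=\frac{1}{Z^{\rm loops}}\,\vartheta^{|\mathcal L(\omega)|}\rho({\rm d}\omega),$$ where $Z^{\rm cycles}$ and $Z^{\rm loops}$ are the normalizations, and where $\Lambda$ is assumed to be bipartite in the case of loops. Let $$a=\begin{cases}\vartheta^{-1}(1-e^{-\beta}) & \text{if }\vartheta\le1,\\ 1-e^{-\beta} & \text{if }\vartheta\ge1,\end{cases}\quad\text{for cycles},\qquad a=\begin{cases}\vartheta^{-1}(1-e^{-\beta}) & \text{if }\vartheta\le1,\\ e^{-\beta}(e^{\beta\vartheta}-1) & \text{if }\vartheta\ge1,\end{cases}\quad\text{for loops}.$$ Then, for either measure $\mathbb P$ and the corresponding $a$, for every $x\in\mathcal V$ and every real number $k\ge1$, $$\mathbb P\bigl(L(\gamma_x)>\beta k\bigr)\;\le\;\bigl(a(\kappa-1)\bigr)^{-1}\Bigl[a\kappa\bigl(1-\tfrac1\kappa\bigr)^{-\kappa+1}\Bigr]^{k}.$$ -/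

import Mathlib

open MeasureTheory Set
open scoped ENNReal

/-! ### The Poisson edge process -/

/-- A finite list of times (in no particular order): a realisation of a point process on `[0, β]`. -/
abbrev TimeList : Type := Σ n : ℕ, (Fin n → ℝ)

/-- The law of the Poisson point process of unit intensity on `[0, β]`: the number of points is `n`
with probability `e^{-β} β^n / n!` and, given `n`, the points are independent and uniform on
`[0, β]` (the restricted Lebesgue measure below has total mass `β`). -/
noncomputable def poissonTimes (β : ℝ) : Measure TimeList :=
  Measure.sum fun n : ℕ =>
    ENNReal.ofReal (Real.exp (-β) / (n.factorial : ℝ)) •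
      (Measure.pi fun _ : Fin n => (volume : Measure ℝ).restrict (Icc 0 β)).map
        (fun t : Fin n → ℝ => (⟨n, t⟩ : TimeList))

/-- A realisation of the Poisson edge process: a finite list of times on every edge. -/
abbrev EdgeConfig {V : Type*} (G : SimpleGraph V) : Type _ := G.edgeSet → TimeList

/-- The Poisson edge measure: independent Poisson point processes on `[0, β]`, one for each edge. -/
noncomputable def poissonEdge {V : Type*} [Fintype V] [DecidableEq V]
    (G : SimpleGraph V) [DecidableRel G.Adj] (β : ℝ) : Measure (EdgeConfig G) :=
  Measure.pi fun _ : G.edgeSet => poissonTimes β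

/-- The bridges of `ω`: the pairs (edge, time), the time being read on the circle `[0, β]_per`. -/
def bridges {V : Type*} {G : SimpleGraph V} (β : ℝ) (ω : EdgeConfig G) :
    Set (Sym2 V × AddCircle β) :=
  {b | ∃ (e : G.edgeSet) (i : Fin (ω e).1), b = ((e : Sym2 V), (((ω e).2 i : ℝ) : AddCircle β))}

/-! ### Closed trajectories on the cylinder `V × [0, β]_per`

A vertex `x` carries a vertical velocity `σ x`. Cycles are the case `σ = 1`; loops are the case
where `σ` is `1` on one side of a bipartition and `-1` on the other. -/

/-- The vertex that is occupied just after arriving at the vertex `x` at time `t` is `y`: a bridge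
at `(x, t)` is crossed, and in the absence of such a bridge the vertex does not change. -/
def Continues {V : Type*} {β : ℝ} (B : Set (Sym2 V × AddCircle β))
    (x : V) (t : AddCircle β) (y : V) : Prop :=
  (s(x, y), t) ∈ B ∨ (y = x ∧ ∀ z : V, (s(x, z), t) ∉ B)

/-- `γ : [0, L] → V × [0, β]_per` is a closed trajectory for the set of bridges `B`, and `L` is its
length: `γ` is piecewise continuous, the vertex is constant and the time moves with velocity `σ` on
intervals of continuity, `γ` is left-continuous, it jumps exactly at the bridges, and `L` is the
smallest positive number such that `γ L = γ 0`. -/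
structure IsClosedTrajectory {V : Type*} {β : ℝ} (σ : V → ℝ) (B : Set (Sym2 V × AddCircle β))
    (L : ℝ) (γ : ℝ → V × AddCircle β) : Prop where
  left : ∀ τ ∈ Ioc 0 L, ∃ ε > 0, ∀ s ∈ Icc 0 L, τ - ε < s → s < τ →
    γ s = ((γ τ).1, (γ τ).2 - ((σ (γ τ).1 * (τ - s) : ℝ) : AddCircle β))
  right : ∀ τ ∈ Ico 0 L, ∃ y : V, Continues B (γ τ).1 (γ τ).2 y ∧
    ∃ ε > 0, ∀ s ∈ Icc 0 L, τ < s → s < τ + ε →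
      γ s = (y, (γ τ).2 + ((σ y * (s - τ) : ℝ) : AddCircle β))
  pos : 0 < L
  closed : γ L = γ 0
  minimal : ∀ s ∈ Ioo 0 L, γ s ≠ γ 0

/-- The set of closed trajectories, where trajectories with the same support are identified. -/
def trajectorySupports {V : Type*} {β : ℝ} (σ : V → ℝ) (B : Set (Sym2 V × AddCircle β)) :
    Set (Set (V × AddCircle β)) :=
  {S | ∃ (L : ℝ) (γ : ℝ → V × AddCircle β), IsClosedTrajectory σ B L γ ∧ S = γ '' Icc 0 L}

/-- The length of the closed trajectory that contains `(x, 0)`. (If `B` is finite and no two bridges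
at the same time share a vertex, the set below has exactly one element.) -/
noncomputable def lengthAt {V : Type*} {β : ℝ} (σ : V → ℝ) (B : Set (Sym2 V × AddCircle β))
    (x : V) : ℝ :=
  sSup {L | ∃ γ : ℝ → V × AddCircle β,
    IsClosedTrajectory σ B L γ ∧ (x, (0 : AddCircle β)) ∈ γ '' Icc 0 L}

/-! ### Cycles and loops -/

/-- Cycles move upwards at every vertex. -/
def cycleVelocity {V : Type*} : V → ℝ := fun _ => 1

/-- Loops on a bipartite graph move upwards on one sublattice and downwards on the other one. -/
def loopVelocity {V : Type*} {G : SimpleGraph V} (A : G.Coloring Bool) : V → ℝ :=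
  fun x => if A x = true then 1 else -1

/-- The probability measure proportional to `ϑ ^ N(ω) ρ(dω)`, where `ρ` is the Poisson edge measure
and `N(ω)` is the number of closed trajectories with velocity `σ`. -/
noncomputable def weightedMeasure {V : Type*} [Fintype V] [DecidableEq V]
    (G : SimpleGraph V) [DecidableRel G.Adj] (σ : V → ℝ) (β ϑ : ℝ) : Measure (EdgeConfig G) :=
  (∫⁻ ω, ENNReal.ofReal (ϑ ^ (trajectorySupports σ (bridges β ω)).ncard) ∂(poissonEdge G β))⁻¹ •
    (poissonEdge G β).withDensity
      fun ω => ENNReal.ofReal (ϑ ^ (trajectorySupports σ (bridges β ω)).ncard)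

/-- The measure of the cycle model. -/
noncomputable def cycleMeasure {V : Type*} [Fintype V] [DecidableEq V]
    (G : SimpleGraph V) [DecidableRel G.Adj] (β ϑ : ℝ) : Measure (EdgeConfig G) :=
  weightedMeasure G cycleVelocity β ϑ

/-- The measure of the loop model on a bipartite graph. -/
noncomputable def loopMeasure {V : Type*} [Fintype V] [DecidableEq V]
    (G : SimpleGraph V) [DecidableRel G.Adj] (A : G.Coloring Bool) (β ϑ : ℝ) :
    Measure (EdgeConfig G) :=
  weightedMeasure G (loopVelocity A) β ϑ

/-- The length `L(γ_x)` of the cycle that contains `(x, 0)`. -/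
noncomputable def cycleLength {V : Type*} {G : SimpleGraph V} (β : ℝ) (ω : EdgeConfig G)
    (x : V) : ℝ :=
  lengthAt cycleVelocity (bridges β ω) x

/-- The length `L(γ_x)` of the loop that contains `(x, 0)`. -/
noncomputable def loopLength {V : Type*} {G : SimpleGraph V} (A : G.Coloring Bool) (β : ℝ)
    (ω : EdgeConfig G) (x : V) : ℝ :=
  lengthAt (loopVelocity A) (bridges β ω) x

/-! ### The small parameter -/

/-- The parameter `a` for cycles. -/
noncomputable def aCycles (β ϑ : ℝ) : ℝ :=
  if ϑ ≤ 1 then ϑ⁻¹ * (1 - Real.exp (-β)) else 1 - Real.exp (-β)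

/-- The parameter `a` for loops. -/
noncomputable def aLoops (β ϑ : ℝ) : ℝ :=
  if ϑ ≤ 1 then ϑ⁻¹ * (1 - Real.exp (-β)) else Real.exp (-β) * (Real.exp (β * ϑ) - 1)

/-- The right side `(a (κ - 1))⁻¹ [a κ (1 - 1/κ)^{-κ+1}]^k`. -/
noncomputable def decayBound (a : ℝ) (κ : ℕ) (k : ℝ) : ℝ :=
  (a * ((κ : ℝ) - 1))⁻¹ * (a * (κ : ℝ) * (1 - 1 / (κ : ℝ)) ^ (-(κ : ℝ) + 1)) ^ k

/-!
The proof is a cluster expansion that treats cycles and loops, and all values of `ϑ`, in the same way.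

Let `O(ω)` be the set of edges that carry a bridge, let `W` be the set of vertices connected to `x` by
`O(ω)`, and let `F ⊆ O(ω)` be the set of edges at `W`. A trajectory through `(x, 0)` never leaves `W`,
it is injective up to its length, and it moves at unit speed. Its length is therefore at most `β |W|`
(`IsClosedTrajectory.length_le`), and `L(γ_x) > β k` forces `|W| > k`.

The number of trajectories is the sum of the number above `W` and the number above its complement, and
the latter does not see the bridges on `F`. If these bridges are erased, there are exactly `|W|`
trajectories above `W`. Comparison with the erased configuration bounds the probability that the
cluster of `x` is `F` (`withDensity_clusterEdges_le`) by `w ^ |F| * c ^ (|W| - 1)`, where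
* for `ϑ ≤ 1`, `w = e ^ β - 1` and `c = 1 / ϑ`, because there is at least one trajectory above `W`;
* for cycles and `ϑ ≥ 1`, `w = e ^ β - 1` and `c = 1`, because each cycle passes through time `0`, so
  that there are at most `|W|` of them;
* for loops and `ϑ ≥ 1`, `w = e ^ (β ϑ) - 1` and `c = 1`, because each loop passes through time `0` or
  arrives at a bridge in the upward direction, so that there are at most `|W|` loops plus one for each
  bridge.

In all cases `w c = a e ^ β`. It remains to sum over the possible clusters `F` with `|W| > k`. An
exploration, edge by edge, bounds the generating function of all clusters at once
(`sum_isClusterSet_le`): with `φ = κ / (κ - 1)`, the sum of `w ^ |F| * z ^ (|W| - 1)` is at most `φ ^ κ`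
whenever `1 + w z φ ^ (κ - 1) ≤ φ` and `1 + w ≤ φ ^ 2`. Let `b = a κ φ ^ (κ - 1)`. The right side of the
theorem is `φ ^ κ * b ^ (k - 1)`. It is at least `1` if `b ≥ 1`; if `b < 1`, then `e ^ β ≤ φ`, and
`z = c / b` is admissible.

No measurability of the number of trajectories is needed: lower integrals of arbitrary functions are
bounded by iterated lower integrals (`withDensity_prod_mul_le`). Almost surely, no two bridges on
different edges are at the same time (`ae_isMatched`), which makes the motion deterministic.
-/

/-! ### Flow lines -/

/-- Induction along `[0, ∞)` for a property that propagates both to the right and to suprema. -/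
theorem forall_nonneg_of_step {P : ℝ → Prop} (h0 : P 0)
    (hr : ∀ τ, 0 ≤ τ → P τ → ∃ ε > 0, ∀ s, τ < s → s < τ + ε → P s)
    (hl : ∀ τ, 0 < τ → (∀ s, 0 ≤ s → s < τ → P s) → P τ) : ∀ τ, 0 ≤ τ → P τ := by
  by_contra! hcon
  obtain ⟨τ₁, hτ₁, hP₁⟩ := hcon
  set A : Set ℝ := {τ | 0 ≤ τ ∧ ¬ P τ}
  have hbdd : BddBelow A := ⟨0, fun τ hτ => hτ.1⟩
  have hne : A.Nonempty := ⟨τ₁, hτ₁, hP₁⟩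
  have hm0 : 0 ≤ sInf A := le_csInf hne fun τ hτ => hτ.1
  have hlt : ∀ s, 0 ≤ s → s < sInf A → P s := fun s hs hsA => by
    by_contra hPs
    exact absurd (csInf_le hbdd (show s ∈ A from ⟨hs, hPs⟩)) (not_le.2 hsA)
  have hPm : P (sInf A) := by
    rcases hm0.eq_or_lt with h | h
    · rwa [← h]
    · exact hl _ h hlt
  obtain ⟨ε, hε, hstep⟩ := hr _ hm0 hPm
  obtain ⟨τ, hτA, hτ⟩ := exists_lt_of_csInf_lt hne (show sInf A < sInf A + ε by linarith)
  rcases (csInf_le hbdd hτA).eq_or_lt with h | h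
  · exact hτA.2 (h ▸ hPm)
  · exact hτA.2 (hstep τ h hτ)

/-- No two bridges at the same time share a vertex: the jumps of a trajectory are determined. -/
def IsMatched {V : Type*} {β : ℝ} (B : Set (Sym2 V × AddCircle β)) : Prop :=
  ∀ (x y z : V) (t : AddCircle β), (s(x, y), t) ∈ B → (s(x, z), t) ∈ B → y = z

theorem Continues.unique {V : Type*} {β : ℝ} {B : Set (Sym2 V × AddCircle β)} (hB : IsMatched B)
    {x y z : V} {t : AddCircle β} (hy : Continues B x t y) (hz : Continues B x t z) : y = z := by
  rcases hy with hy | ⟨rfl, hy⟩ <;> rcases hz with hz | ⟨rfl, hz⟩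
  · exact hB _ _ _ _ hy hz
  · exact absurd hy (hz _)
  · exact absurd hz (hy _)
  · rfl

/-- The local rules of a closed trajectory, imposed on the whole time line: `Γ` moves vertically
with velocity `σ`, is left-continuous, and jumps exactly at the bridges. The periodic extension of a
closed trajectory is such a flow line. -/
structure IsFlowLine {V : Type*} {β : ℝ} (σ : V → ℝ) (B : Set (Sym2 V × AddCircle β))
    (Γ : ℝ → V × AddCircle β) : Prop where
  left : ∀ τ, ∃ ε > 0, ∀ s, τ - ε < s → s < τ →
    Γ s = ((Γ τ).1, (Γ τ).2 - ((σ (Γ τ).1 * (τ - s) : ℝ) : AddCircle β))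
  right : ∀ τ, ∃ y : V, Continues B (Γ τ).1 (Γ τ).2 y ∧
    ∃ ε > 0, ∀ s, τ < s → s < τ + ε →
      Γ s = (y, (Γ τ).2 + ((σ y * (s - τ) : ℝ) : AddCircle β))

section Flow

variable {V : Type*} {β : ℝ} {σ : V → ℝ} {B : Set (Sym2 V × AddCircle β)}

theorem IsFlowLine.comp_add {Γ : ℝ → V × AddCircle β} (h : IsFlowLine σ B Γ) (a : ℝ) :
    IsFlowLine σ B (fun τ => Γ (a + τ)) where
  left τ := by
    obtain ⟨ε, hε, H⟩ := h.left (a + τ)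
    refine ⟨ε, hε, fun s h1 h2 => ?_⟩
    rw [H (a + s) (by linarith) (by linarith), add_sub_add_left_eq_sub]
  right τ := by
    obtain ⟨y, hy, ε, hε, H⟩ := h.right (a + τ)
    refine ⟨y, hy, ε, hε, fun s h1 h2 => ?_⟩
    rw [H (a + s) (by linarith) (by linarith), add_sub_add_left_eq_sub]

/-- A flow line is determined by any of its points, in the direction of increasing time. -/
theorem IsFlowLine.eq_of_eq (hB : IsMatched B) {Γ Δ : ℝ → V × AddCircle β}
    (hΓ : IsFlowLine σ B Γ) (hΔ : IsFlowLine σ B Δ) (h0 : Γ 0 = Δ 0) :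
    ∀ τ, 0 ≤ τ → Γ τ = Δ τ := by
  refine forall_nonneg_of_step h0 (fun τ _ hτ => ?_) (fun τ hτ0 hτ => ?_)
  · obtain ⟨y, hy, ε, hε, H⟩ := hΓ.right τ
    obtain ⟨z, hz, δ, hδ, K⟩ := hΔ.right τ
    rw [← hτ] at hz
    obtain rfl := hy.unique hB hz
    refine ⟨min ε δ, lt_min hε hδ, fun s h1 h2 => ?_⟩
    rw [H s h1 (by linarith [min_le_left ε δ]), K s h1 (by linarith [min_le_right ε δ]), hτ]
  · obtain ⟨ε, hε, H⟩ := hΓ.left τ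
    obtain ⟨δ, hδ, K⟩ := hΔ.left τ
    obtain ⟨s, hs, hsτ⟩ := exists_between (show max (max (τ - ε) (τ - δ)) 0 < τ by
      simp [hε, hδ, hτ0])
    simp only [max_lt_iff] at hs
    have hv := hτ s hs.2.le hsτ
    rw [H s hs.1.1 hsτ, K s hs.1.2 hsτ, Prod.mk.injEq] at hv
    refine Prod.ext hv.1 ?_
    rw [hv.1] at hv
    exact sub_left_injective hv.2

/-- A flow line stays in a set of vertices that no bridge leaves. -/
theorem IsFlowLine.mem_of_closed {W : Set V} (hW : ∀ a b t, (s(a, b), t) ∈ B → a ∈ W → b ∈ W)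
    {Γ : ℝ → V × AddCircle β} (hΓ : IsFlowLine σ B Γ) (h0 : (Γ 0).1 ∈ W) :
    ∀ τ, 0 ≤ τ → (Γ τ).1 ∈ W := by
  refine forall_nonneg_of_step h0 (fun τ _ hτ => ?_) (fun τ hτ0 hτ => ?_)
  · obtain ⟨y, hy, ε, hε, H⟩ := hΓ.right τ
    refine ⟨ε, hε, fun s h1 h2 => ?_⟩
    rw [H s h1 h2]
    rcases hy with hy | ⟨rfl, -⟩
    · exact hW _ _ _ hy hτ
    · exact hτ
  · obtain ⟨ε, hε, H⟩ := hΓ.left τ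
    obtain ⟨s, hs, hsτ⟩ := exists_between (show max (τ - ε) 0 < τ by simp [hε, hτ0])
    simp only [max_lt_iff] at hs
    have hv := hτ s hs.2.le hsτ
    rwa [H s hs.1 hsτ] at hv

theorem periodic_sub_int {X : Type*} {Γ : ℝ → X} {L : ℝ} (h : Function.Periodic Γ L) (τ : ℝ)
    (m : ℤ) : Γ (τ + m * L) = Γ τ := by
  simpa using h.int_mul m τ

/-- The points of a periodic function on a half-line are all its points. -/
theorem exists_ge_of_periodic {X : Type*} {Γ : ℝ → X} {L : ℝ} (hL : 0 < L)
    (h : Function.Periodic Γ L) (a τ : ℝ) : ∃ s, 0 ≤ s ∧ Γ (a + s) = Γ τ := by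
  obtain ⟨n, hn⟩ := exists_nat_ge ((a - τ) / L)
  rw [div_le_iff₀ hL] at hn
  refine ⟨τ + n * L - a, by linarith, ?_⟩
  rw [add_sub_cancel]
  simpa using h.nat_mul n τ

/-- The periodic extension of a closed trajectory. -/
theorem IsClosedTrajectory.exists_flowLine {L : ℝ} {γ : ℝ → V × AddCircle β}
    (h : IsClosedTrajectory σ B L γ) :
    ∃ Γ : ℝ → V × AddCircle β, IsFlowLine σ B Γ ∧ Function.Periodic Γ L ∧
      range Γ = γ '' Icc 0 L ∧ ∀ s ∈ Ioo 0 L, Γ s ≠ Γ 0 := by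
  have hL := h.pos
  set Γ : ℝ → V × AddCircle β := fun τ => γ (toIcoMod hL 0 τ) with hΓ
  have hper : Function.Periodic Γ L := fun τ => by simp [hΓ]
  have hval : ∀ τ ∈ Icc 0 L, Γ τ = γ τ := by
    intro τ hτ
    rcases hτ.2.eq_or_lt with rfl | hlt
    · have : toIcoMod hL 0 τ = 0 := by simpa using toIcoMod_apply_right hL 0
      simp [hΓ, this, h.closed]
    · have : toIcoMod hL 0 τ = τ := (toIcoMod_eq_self hL).2 ⟨hτ.1, by simpa using hlt⟩
      simp [hΓ, this]
  refine ⟨Γ, ⟨fun τ => ?_, fun τ => ?_⟩, hper, ?_, fun s hs => ?_⟩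
  · -- shift `τ` into `(0, L]`
    set m : ℤ := toIocDiv hL 0 τ
    set r : ℝ := toIocMod hL 0 τ
    have hτ : τ = r + m * L := by
      rw [← zsmul_eq_mul]
      exact (toIocMod_add_toIocDiv_zsmul hL 0 τ).symm
    have hr : r ∈ Ioc 0 L := by simpa using toIocMod_mem_Ioc hL 0 τ
    obtain ⟨ε, hε, H⟩ := h.left r hr
    refine ⟨min ε r, lt_min hε hr.1, fun s h1 h2 => ?_⟩
    have hs : Γ s = γ (s - m * L) := by
      rw [← hval]
      · conv_lhs => rw [← sub_add_cancel s (m * L)]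
        exact periodic_sub_int hper _ m
      · constructor <;> linarith [min_le_right ε r, hr.2]
    have hτ' : Γ τ = γ r := by
      rw [hτ, periodic_sub_int hper, hval r ⟨hr.1.le, hr.2⟩]
    rw [hs, hτ', H]
    · rw [show r - (s - m * L) = τ - s by linarith]
    · constructor <;> linarith [min_le_right ε r, hr.2]
    · linarith [min_le_left ε r]
    · linarith
  · set m : ℤ := toIcoDiv hL 0 τ
    set r : ℝ := toIcoMod hL 0 τ
    have hτ : τ = r + m * L := by
      rw [← zsmul_eq_mul]
      exact (toIcoMod_add_toIcoDiv_zsmul hL 0 τ).symm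
    have hr : r ∈ Ico 0 L := by simpa using toIcoMod_mem_Ico hL 0 τ
    obtain ⟨y, hy, ε, hε, H⟩ := h.right r hr
    have hτ' : Γ τ = γ r := by
      rw [hτ, periodic_sub_int hper, hval r ⟨hr.1, hr.2.le⟩]
    refine ⟨y, by rwa [hτ'], min ε (L - r), lt_min hε (by linarith [hr.2]), fun s h1 h2 => ?_⟩
    have hs : Γ s = γ (s - m * L) := by
      rw [← hval]
      · conv_lhs => rw [← sub_add_cancel s (m * L)]
        exact periodic_sub_int hper _ m
      · constructor <;> linarith [min_le_right ε (L - r), hr.1]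
    rw [hs, hτ', H]
    · rw [show s - m * L - r = s - τ by linarith]
    · constructor <;> linarith [min_le_right ε (L - r), hr.1]
    · linarith
    · linarith [min_le_left ε (L - r)]
  · ext p
    constructor
    · rintro ⟨τ, rfl⟩
      have := toIcoMod_mem_Ico hL 0 τ
      exact ⟨_, ⟨this.1, by simpa using this.2.le⟩, rfl⟩
    · rintro ⟨τ, hτ, rfl⟩
      exact ⟨τ, hval τ hτ⟩
  · rw [hval s ⟨hs.1.le, hs.2.le⟩, hval 0 ⟨le_rfl, hL.le⟩]
    exact h.minimal s hs

/-- Two supports of closed trajectories that meet are equal. -/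
theorem eq_of_mem_trajectorySupports (hB : IsMatched B) {S T : Set (V × AddCircle β)}
    (hS : S ∈ trajectorySupports σ B) (hT : T ∈ trajectorySupports σ B) {p : V × AddCircle β}
    (hpS : p ∈ S) (hpT : p ∈ T) : S = T := by
  suffices key : ∀ S ∈ trajectorySupports σ B, ∀ T ∈ trajectorySupports σ B, p ∈ S → p ∈ T →
      S ⊆ T from (key S hS T hT hpS hpT).antisymm (key T hT S hS hpT hpS)
  rintro S ⟨L, γ, hγ, rfl⟩ T ⟨M, δ, hδ, rfl⟩ hpS hpT
  obtain ⟨Γ, hΓ, hΓper, hΓr, -⟩ := hγ.exists_flowLine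
  obtain ⟨Δ, hΔ, -, hΔr, -⟩ := hδ.exists_flowLine
  rw [← hΓr] at hpS ⊢
  rw [← hΔr] at hpT ⊢
  obtain ⟨a, ha⟩ := hpS
  obtain ⟨b, hb⟩ := hpT
  rintro _ ⟨τ, rfl⟩
  obtain ⟨s, hs, hsτ⟩ := exists_ge_of_periodic hγ.pos hΓper a τ
  have := (hΓ.comp_add a).eq_of_eq hB (hΔ.comp_add b) (by simp [ha, hb]) s hs
  exact ⟨b + s, by rw [← this, hsτ]⟩

theorem subset_of_mem_trajectorySupports {W : Set V}
    (hW : ∀ a b t, (s(a, b), t) ∈ B → a ∈ W → b ∈ W) {S : Set (V × AddCircle β)}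
    (hS : S ∈ trajectorySupports σ B) {p : V × AddCircle β} (hp : p ∈ S) (hpW : p.1 ∈ W) :
    S ⊆ Prod.fst ⁻¹' W := by
  obtain ⟨L, γ, hγ, rfl⟩ := hS
  obtain ⟨Γ, hΓ, hΓper, hΓr, -⟩ := hγ.exists_flowLine
  rw [← hΓr] at hp ⊢
  obtain ⟨a, rfl⟩ := hp
  rintro _ ⟨τ, rfl⟩
  obtain ⟨s, hs, hsτ⟩ := exists_ge_of_periodic hγ.pos hΓper a τ
  rw [← hsτ]
  exact (hΓ.comp_add a).mem_of_closed hW (by simpa using hpW) s hs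

theorem nonempty_of_mem_trajectorySupports {S : Set (V × AddCircle β)}
    (hS : S ∈ trajectorySupports σ B) : S.Nonempty := by
  obtain ⟨L, γ, hγ, rfl⟩ := hS
  exact ⟨γ 0, 0, ⟨le_rfl, hγ.pos.le⟩, rfl⟩

/-- Closed trajectories are injective up to their length. -/
theorem IsFlowLine.injOn (hB : IsMatched B) {Γ : ℝ → V × AddCircle β} {L : ℝ} (hL : 0 < L)
    (hΓ : IsFlowLine σ B Γ) (hper : Function.Periodic Γ L) (hmin : ∀ s ∈ Ioo 0 L, Γ s ≠ Γ 0) :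
    ∀ s t, s < t → t < s + L → Γ s ≠ Γ t := by
  intro s t hst hts heq
  have h := (hΓ.comp_add s).eq_of_eq hB (hΓ.comp_add t) (by simpa using heq)
  obtain ⟨n, hn⟩ := exists_nat_ge (s / L)
  rw [div_le_iff₀ hL] at hn
  have h1 := h (n * L - s) (by linarith)
  apply hmin (t - s) ⟨by linarith, by linarith⟩
  have e1 : s + (n * L - s) = 0 + n * L := by ring
  have e2 : t + (n * L - s) = (t - s) + n * L := by ring
  rw [e1, e2] at h1
  have h2 := hper.nat_mul n 0
  have h3 := hper.nat_mul n (t - s)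
  rw [← h3, ← h1, h2]

end Flow

/-! ### Length of closed trajectories -/

section Length

variable {V : Type*} {β : ℝ} {σ : V → ℝ} {B : Set (Sym2 V × AddCircle β)}

theorem ofReal_le_volume_arc [Fact (0 < β)] (c ℓ : ℝ) (hℓ : ℓ ≤ β) :
    ENNReal.ofReal ℓ ≤ volume ((fun t : ℝ => (t : AddCircle β)) '' Ioo c (c + ℓ)) := by
  have hopen : IsOpen ((fun t : ℝ => (t : AddCircle β)) '' Ioo c (c + ℓ)) :=
    QuotientAddGroup.isOpenMap_coe _ isOpen_Ioo
  rw [← (AddCircle.measurePreserving_mk β c).measure_preimage hopen.measurableSet.nullMeasurableSet,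
    Measure.restrict_apply (AddCircle.measurable_mk' hopen.measurableSet)]
  rw [show ENNReal.ofReal ℓ = volume (Ioo c (c + ℓ)) by rw [Real.volume_Ioo]; congr 1; ring]
  exact measure_mono fun t ht => ⟨⟨t, ht, rfl⟩, ht.1, by linarith [ht.2]⟩

/-- An injective flow line sweeps the cylinder at unit speed. This is the step that adds one
vertical piece. -/
theorem sweep_step [DecidableEq V] [Fact (0 < β)] (hσ : ∀ v, σ v = 1 ∨ σ v = -1) (W : Finset V)
    {Γ : ℝ → V × AddCircle β} {s τ θ : ℝ} {y : V} (hs : 0 ≤ s) (hsτ : s < τ) (hβ : τ - s ≤ β)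
    (hy : y ∈ W)
    (hΓ : ∀ r, s < r → r < τ → Γ r = (y, ((θ + σ y * r : ℝ) : AddCircle β)))
    (hinj : ∀ a b, 0 ≤ a → a < b → b ≤ τ → Γ a ≠ Γ b)
    (h : ENNReal.ofReal s ≤ ∑ v ∈ W, volume {t | (v, t) ∈ Γ '' Ioc 0 s}) :
    ENNReal.ofReal τ ≤ ∑ v ∈ W, volume {t | (v, t) ∈ Γ '' Ioc 0 τ} := by
  obtain ⟨c, hc⟩ : ∃ c, ∀ t ∈ Ioo c (c + (τ - s)), ∃ r, s < r ∧ r < τ ∧ t = θ + σ y * r := by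
    rcases hσ y with h1 | h1
    · exact ⟨θ + s, fun t ht => ⟨t - θ, by linarith [ht.1], by linarith [ht.2], by rw [h1]; ring⟩⟩
    · exact ⟨θ - τ, fun t ht => ⟨θ - t, by linarith [ht.2], by linarith [ht.1], by rw [h1]; ring⟩⟩
  set A : Set (AddCircle β) := (fun t : ℝ => (t : AddCircle β)) '' Ioo c (c + (τ - s)) with hA
  have hAopen : IsOpen A := QuotientAddGroup.isOpenMap_coe _ isOpen_Ioo
  have hAmem : ∀ t ∈ A, ∃ r, s < r ∧ r < τ ∧ Γ r = (y, t) := by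
    rintro _ ⟨t, ht, rfl⟩
    obtain ⟨r, h1, h2, rfl⟩ := hc t ht
    exact ⟨r, h1, h2, hΓ r h1 h2⟩
  have hmono : ∀ v, volume {t | (v, t) ∈ Γ '' Ioc 0 s} ≤ volume {t | (v, t) ∈ Γ '' Ioc 0 τ} :=
    fun v => measure_mono fun t ht => image_mono (Ioc_subset_Ioc_right hsτ.le) ht
  have hy' : volume {t | (y, t) ∈ Γ '' Ioc 0 s} + volume A ≤
      volume {t | (y, t) ∈ Γ '' Ioc 0 τ} := by
    rw [← measure_union _ hAopen.measurableSet]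
    · refine measure_mono (union_subset (fun t ht => image_mono (Ioc_subset_Ioc_right hsτ.le) ht) ?_)
      intro t ht
      obtain ⟨r, h1, h2, h3⟩ := hAmem t ht
      exact ⟨r, ⟨by linarith, h2.le⟩, h3⟩
    · rw [Set.disjoint_left]
      rintro t ⟨a, ha, hat⟩ htA
      obtain ⟨r, h1, h2, h3⟩ := hAmem t htA
      exact hinj a r ha.1.le (by linarith [ha.2]) h2.le (hat.trans h3.symm)
  rw [← Finset.add_sum_erase W _ hy] at h ⊢
  calc ENNReal.ofReal τ = ENNReal.ofReal s + ENNReal.ofReal (τ - s) := by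
        rw [← ENNReal.ofReal_add hs (by linarith)]; congr 1; ring
    _ ≤ (volume {t | (y, t) ∈ Γ '' Ioc 0 s} +
          ∑ v ∈ W.erase y, volume {t | (v, t) ∈ Γ '' Ioc 0 s}) + volume A :=
        add_le_add h (ofReal_le_volume_arc c _ hβ)
    _ = (volume {t | (y, t) ∈ Γ '' Ioc 0 s} + volume A) +
          ∑ v ∈ W.erase y, volume {t | (v, t) ∈ Γ '' Ioc 0 s} := by ring
    _ ≤ _ := add_le_add hy' (Finset.sum_le_sum fun v _ => hmono v)

/-- A flow line that is injective on `[0, L)` and stays above `W` has `L ≤ β |W|`. -/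
theorem IsFlowLine.length_le (hβ : 0 < β) (hσ : ∀ v, σ v = 1 ∨ σ v = -1) (W : Finset V)
    {Γ : ℝ → V × AddCircle β} (hΓ : IsFlowLine σ B Γ) {L : ℝ}
    (hinj : ∀ s t, s < t → t < s + L → Γ s ≠ Γ t) (hW : ∀ τ, 0 ≤ τ → (Γ τ).1 ∈ W) :
    L ≤ β * W.card := by
  classical
  have : Fact (0 < β) := ⟨hβ⟩
  have hinj' : ∀ τ, τ < L → ∀ a b, 0 ≤ a → a < b → b ≤ τ → Γ a ≠ Γ b :=
    fun τ hτ a b h0 hab hb => hinj a b hab (by linarith)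
  have key : ∀ τ, 0 ≤ τ → τ < L →
      ENNReal.ofReal τ ≤ ∑ v ∈ W, volume {t | (v, t) ∈ Γ '' Ioc 0 τ} := by
    refine forall_nonneg_of_step (by simp) (fun τ h0 hτ => ?_) (fun τ h0 hτ => ?_)
    · obtain ⟨y, -, ε, hε, H⟩ := hΓ.right τ
      obtain ⟨θ, hθ⟩ := QuotientAddGroup.mk_surjective (Γ τ).2
      refine ⟨min ε β, lt_min hε hβ, fun s h1 h2 hsL => ?_⟩
      have hsε : s < τ + ε := by linarith [min_le_left ε β]
      refine sweep_step (θ := θ - σ y * τ) (y := y) hσ W h0 h1 (by linarith [min_le_right ε β]) ?_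
        (fun r hr1 hr2 => ?_) (hinj' s hsL) (hτ (by linarith))
      · have := hW s (by linarith)
        rwa [H s h1 hsε] at this
      · rw [H r hr1 (by linarith), ← hθ]
        congr 1
        change (θ : AddCircle β) + _ = _
        rw [← AddCircle.coe_add]
        congr 1; ring
    · intro hτL
      obtain ⟨ε, hε, H⟩ := hΓ.left τ
      obtain ⟨θ, hθ⟩ := QuotientAddGroup.mk_surjective (Γ τ).2
      obtain ⟨s, hs, hsτ⟩ := exists_between (show max (max (τ - ε) (τ - β)) 0 < τ by
        simp [hε, hβ, h0])
      simp only [max_lt_iff] at hs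
      refine sweep_step (θ := θ - σ (Γ τ).1 * τ) (y := (Γ τ).1) hσ W hs.2.le hsτ
        (by linarith [hs.1.2]) (hW τ h0.le) (fun r hr1 hr2 => ?_) (hinj' τ hτL)
        (hτ s hs.2.le hsτ (by linarith))
      rw [H r (by linarith [hs.1.1]) hr2, ← hθ]
      congr 1
      change (θ : AddCircle β) - _ = _
      rw [← AddCircle.coe_sub]
      congr 1; ring
  refine le_of_forall_lt fun τ hτ => ?_
  rcases lt_or_ge τ 0 with h0 | h0
  · exact h0.trans_le (by positivity)
  -- the bound is applied at a later time to get a strict inequality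
  obtain ⟨τ', h1, h2⟩ := exists_between hτ
  refine h1.trans_le ?_
  have h := (key τ' (by linarith) h2).trans
    (Finset.sum_le_sum (g := fun _ => ENNReal.ofReal β) fun v _ =>
      (measure_mono (subset_univ _)).trans_eq (AddCircle.measure_univ β))
  rw [Finset.sum_const, nsmul_eq_mul, ← ENNReal.ofReal_natCast, ← ENNReal.ofReal_mul (by positivity),
    ENNReal.ofReal_le_ofReal_iff (by positivity)] at h
  linarith

/-- A closed trajectory through a vertex of a set `W` that no bridge leaves has length at most
`β |W|`. -/
theorem IsClosedTrajectory.length_le (hβ : 0 < β) (hσ : ∀ v, σ v = 1 ∨ σ v = -1)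
    (hB : IsMatched B) (W : Finset V) (hW : ∀ a b t, (s(a, b), t) ∈ B → a ∈ W → b ∈ W)
    {L : ℝ} {γ : ℝ → V × AddCircle β} (hγ : IsClosedTrajectory σ B L γ) {p : V × AddCircle β}
    (hp : p ∈ γ '' Icc 0 L) (hpW : p.1 ∈ W) : L ≤ β * W.card := by
  have hsub := subset_of_mem_trajectorySupports (W := (W : Set V)) hW ⟨L, γ, hγ, rfl⟩ hp hpW
  obtain ⟨Γ, hΓ, hper, hr, hmin⟩ := hγ.exists_flowLine
  refine hΓ.length_le hβ hσ W (hΓ.injOn hB hγ.pos hper hmin) fun τ _ => ?_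
  exact hsub (hr ▸ mem_range_self τ)

end Length

/-! ### Counting closed trajectories -/

section Count

variable {V : Type*} {β : ℝ} {σ : V → ℝ} {B : Set (Sym2 V × AddCircle β)}

/-- The supports of the closed trajectories above the set of vertices `W`. -/
def supportsAbove {V : Type*} {β : ℝ} (σ : V → ℝ) (B : Set (Sym2 V × AddCircle β)) (W : Set V) :
    Set (Set (V × AddCircle β)) :=
  {S | S ∈ trajectorySupports σ B ∧ S ⊆ Prod.fst ⁻¹' W}

/-- The trajectories above `W` depend only on the bridges with an endpoint in `W`. -/
theorem supportsAbove_congr {B' : Set (Sym2 V × AddCircle β)} {W : Set V}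
    (h : ∀ a b t, a ∈ W → ((s(a, b), t) ∈ B ↔ (s(a, b), t) ∈ B')) :
    supportsAbove σ B W = supportsAbove σ B' W := by
  suffices key : ∀ B B' : Set (Sym2 V × AddCircle β),
      (∀ a b t, a ∈ W → ((s(a, b), t) ∈ B ↔ (s(a, b), t) ∈ B')) →
      supportsAbove σ B W ⊆ supportsAbove σ B' W from
    (key B B' h).antisymm (key B' B fun a b t ha => (h a b t ha).symm)
  rintro B B' h S ⟨⟨L, γ, hγ, rfl⟩, hS⟩
  refine ⟨⟨L, γ, ⟨hγ.left, fun τ hτ => ?_, hγ.pos, hγ.closed, hγ.minimal⟩, rfl⟩, hS⟩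
  obtain ⟨y, hy, hε⟩ := hγ.right τ hτ
  have hW : (γ τ).1 ∈ W := hS ⟨τ, ⟨hτ.1, hτ.2.le⟩, rfl⟩
  refine ⟨y, ?_, hε⟩
  simpa only [Continues, h _ _ _ hW] using hy

/-- If every trajectory above `W` passes through a finite set of points, these points bound the
number of trajectories. -/
theorem ncard_supportsAbove_le (hB : IsMatched B) {W : Set V} {M : Set (V × AddCircle β)}
    (hM : M.Finite) (h : ∀ S ∈ supportsAbove σ B W, ∃ p ∈ M, p ∈ S) :
    (supportsAbove σ B W).Finite ∧ (supportsAbove σ B W).ncard ≤ M.ncard := by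
  rcases (supportsAbove σ B W).eq_empty_or_nonempty with h0 | ⟨S₀, hS₀⟩
  · simp [h0]
  have : Nonempty (V × AddCircle β) := ⟨(h S₀ hS₀).choose⟩
  choose! f hfM hfS using h
  have hinj : InjOn f (supportsAbove σ B W) := fun S hS T hT hST =>
    eq_of_mem_trajectorySupports hB hS.1 hT.1 (hfS S hS) (by rw [hST]; exact hfS T hT)
  exact ⟨hM.of_injOn hfM hinj, ncard_le_ncard_of_injOn f hfM hinj hM⟩

/-- Along a vertical line, a flow line reaches a bridge or the time `0`. -/
theorem IsFlowLine.exists_bridge_or_time_zero (hβ : 0 < β) (hσ : ∀ v, σ v = 1 ∨ σ v = -1)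
    {Γ : ℝ → V × AddCircle β} (hΓ : IsFlowLine σ B Γ) {y : V} {ε : ℝ} (hε : 0 < ε)
    (hy : ∀ s, 0 < s → s < ε → Γ s = (y, (Γ 0).2 + ((σ y * s : ℝ) : AddCircle β))) :
    ∃ u > 0, (Γ u).1 = y ∧ ((Γ u).2 = 0 ∨ ∃ z, (s(y, z), (Γ u).2) ∈ B) := by
  by_contra! hcon
  have key : ∀ u, 0 ≤ u → 0 < u → Γ u = (y, (Γ 0).2 + ((σ y * u : ℝ) : AddCircle β)) := by
    refine forall_nonneg_of_step (fun h => absurd h (lt_irrefl _)) (fun τ h0 hτ => ?_)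
      (fun τ h0 hτ _ => ?_)
    · rcases h0.eq_or_lt with rfl | h0
      · exact ⟨ε, hε, fun s h1 h2 _ => hy s h1 (by linarith)⟩
      · have hτ := hτ h0
        have hno := (hcon τ h0 (by rw [hτ])).2
        obtain ⟨z, hz, δ, hδ, H⟩ := hΓ.right τ
        refine ⟨δ, hδ, fun s h1 h2 _ => ?_⟩
        have hz1 : (Γ τ).1 = y := by rw [hτ]
        rw [hz1] at hz
        rcases hz with hz | ⟨rfl, -⟩
        · exact absurd hz (hno z)
        · rw [H s h1 h2, hτ]
          simp only [Prod.mk.injEq, true_and]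
          rw [add_assoc, ← AddCircle.coe_add]
          congr 2; ring
    · obtain ⟨δ, hδ, H⟩ := hΓ.left τ
      obtain ⟨s, hs, hsτ⟩ := exists_between (show max (τ - δ) 0 < τ by simp [hδ, h0])
      simp only [max_lt_iff] at hs
      have hv := hτ s hs.2.le hsτ hs.2
      rw [H s hs.1 hsτ, Prod.mk.injEq] at hv
      refine Prod.ext hv.1 ?_
      have h2 := hv.2
      rw [hv.1, sub_eq_iff_eq_add, add_assoc, ← AddCircle.coe_add] at h2
      rw [h2]
      congr 2; ring
  obtain ⟨θ, hθ⟩ := QuotientAddGroup.mk_surjective (Γ 0).2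
  obtain ⟨u, hu, m, hm⟩ : ∃ u > 0, ∃ m : ℤ, θ + σ y * u = m * β := by
    obtain ⟨n, hn⟩ := exists_nat_gt (|θ| / β)
    rw [div_lt_iff₀ hβ] at hn
    rcases hσ y with h | h
    · exact ⟨n * β - θ, by linarith [le_abs_self θ], n, by rw [h]; push_cast; ring⟩
    · exact ⟨n * β + θ, by linarith [neg_abs_le θ], -n, by rw [h]; push_cast; ring⟩
  have h := key u hu.le hu
  refine (hcon u hu (by rw [h])).1 ?_
  rw [h]
  change (Γ 0).2 + _ = _
  rw [← hθ]
  change (θ : AddCircle β) + _ = _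
  rw [← AddCircle.coe_add, hm, AddCircle.coe_eq_zero_iff]
  exact ⟨m, by simp⟩

/-- If all velocities are `1`, every trajectory passes through time `0`. -/
theorem exists_mem_time_zero (hβ : 0 < β) {S : Set (V × AddCircle β)}
    (hS : S ∈ trajectorySupports cycleVelocity B) : ∃ p ∈ S, p.2 = 0 := by
  obtain ⟨L, γ, hγ, rfl⟩ := hS
  obtain ⟨Γ, hΓ, -, hr, -⟩ := hγ.exists_flowLine
  rw [← hr]
  have key : ∀ u, 0 ≤ u → (Γ u).2 = (Γ 0).2 + (u : AddCircle β) := by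
    refine forall_nonneg_of_step (by simp) (fun τ h0 hτ => ?_) (fun τ h0 hτ => ?_)
    · obtain ⟨z, hz, δ, hδ, H⟩ := hΓ.right τ
      refine ⟨δ, hδ, fun s h1 h2 => ?_⟩
      rw [H s h1 h2]
      simp only [hτ, cycleVelocity, one_mul]
      rw [add_assoc, ← AddCircle.coe_add]
      congr 2; ring
    · obtain ⟨δ, hδ, H⟩ := hΓ.left τ
      obtain ⟨s, hs, hsτ⟩ := exists_between (show max (τ - δ) 0 < τ by simp [hδ, h0])
      simp only [max_lt_iff] at hs
      have hv := hτ s hs.2.le hsτ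
      rw [H s hs.1 hsτ] at hv
      simp only [cycleVelocity, one_mul] at hv
      rw [sub_eq_iff_eq_add, add_assoc, ← AddCircle.coe_add] at hv
      rw [hv]
      congr 2; ring
  obtain ⟨θ, hθ⟩ := QuotientAddGroup.mk_surjective (Γ 0).2
  obtain ⟨n, hn⟩ := exists_nat_gt (|θ| / β)
  rw [div_lt_iff₀ hβ] at hn
  refine ⟨_, mem_range_self (n * β - θ), ?_⟩
  rw [key _ (by linarith [le_abs_self θ]), ← hθ]
  change (θ : AddCircle β) + _ = _
  rw [← AddCircle.coe_add, AddCircle.coe_eq_zero_iff]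
  exact ⟨n, by simp⟩

/-- If bridges connect opposite velocities, every trajectory passes through time `0` or arrives at
some bridge with velocity `1`. -/
theorem exists_mem_time_zero_or_bridge (hβ : 0 < β) (hσ : ∀ v, σ v = 1 ∨ σ v = -1)
    (hσB : ∀ a b t, (s(a, b), t) ∈ B → σ b = -σ a) {S : Set (V × AddCircle β)}
    (hS : S ∈ trajectorySupports σ B) :
    ∃ p ∈ S, p.2 = 0 ∨ (σ p.1 = 1 ∧ ∃ z, (s(p.1, z), p.2) ∈ B) := by
  obtain ⟨L, γ, hγ, rfl⟩ := hS
  obtain ⟨Γ, hΓ, -, hr, -⟩ := hγ.exists_flowLine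
  rw [← hr]
  -- after a departure from a vertex with velocity `1`, the next bridge or passage through time `0`
  -- gives such a point
  have up : ∀ a y, σ y = 1 → (∃ ε > 0, ∀ s, a < s → s < a + ε →
      Γ s = (y, (Γ a).2 + ((σ y * (s - a) : ℝ) : AddCircle β))) →
      ∃ p ∈ range Γ, p.2 = 0 ∨ (σ p.1 = 1 ∧ ∃ z, (s(p.1, z), p.2) ∈ B) := by
    rintro a y hy ⟨ε, hε, H⟩
    obtain ⟨u, -, hu1, hu⟩ := (hΓ.comp_add a).exists_bridge_or_time_zero hβ hσ (y := y) hε (fun s h1 h2 => by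
      rw [H (a + s) (by linarith) (by linarith)]; simp)
    refine ⟨_, mem_range_self (a + u), hu.imp id fun h => ?_⟩
    rw [hu1]
    exact ⟨hy, h⟩
  obtain ⟨y, -, ε, hε, H⟩ := hΓ.right 0
  rcases hσ y with hy | hy
  · exact up 0 y hy ⟨ε, hε, H⟩
  · obtain ⟨u, hu0, hu1, hu | ⟨z, hz⟩⟩ := hΓ.exists_bridge_or_time_zero hβ hσ (y := y) hε (fun s h1 h2 => by
      rw [H s h1 (by linarith)]; simp)
    · exact ⟨_, mem_range_self u, Or.inl hu⟩
    · obtain ⟨y', hy', hε'⟩ := hΓ.right u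
      rw [hu1] at hy'
      rcases hy' with hy' | ⟨-, hno⟩
      · exact up u y' (by rw [hσB _ _ _ hy', hy]; norm_num) hε'
      · exact absurd hz (hno z)

/-- Above a vertex without bridges there is exactly one trajectory: the vertical circle. -/
theorem vertical_mem_trajectorySupports (hβ : 0 < β) (hσ : ∀ v, σ v = 1 ∨ σ v = -1) {v : V}
    (hv : ∀ z t, (s(v, z), t) ∉ B) : ({v} ×ˢ univ : Set (V × AddCircle β)) ∈
      trajectorySupports σ B := by
  have : Fact (0 < β) := ⟨hβ⟩
  refine ⟨β, fun τ => (v, ((σ v * τ : ℝ) : AddCircle β)), ⟨fun τ _ => ⟨1, one_pos, fun s _ _ _ => ?_⟩,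
    fun τ _ => ⟨v, Or.inr ⟨rfl, fun z => hv z _⟩, 1, one_pos, fun s _ _ _ => ?_⟩, hβ, ?_, ?_⟩, ?_⟩
  · simp only [Prod.mk.injEq, true_and]
    rw [← AddCircle.coe_sub]; congr 1; ring
  · simp only [Prod.mk.injEq, true_and]
    rw [← AddCircle.coe_add]; congr 1; ring
  · rcases hσ v with h | h <;> simp [h]
  · intro s hs heq
    simp only [Prod.mk.injEq, true_and, mul_zero, AddCircle.coe_zero] at heq
    rw [AddCircle.coe_eq_zero_iff] at heq
    obtain ⟨n, hn⟩ := heq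
    have hn' : (n : ℝ) * β = s ∨ (n : ℝ) * β = -s := by
      rcases hσ v with h | h <;> rw [h] at hn <;> simp at hn <;> simp [hn]
    have : (|n| : ℝ) * β = s := by
      rw [← abs_of_pos hβ, ← abs_mul, ← abs_of_pos hs.1]
      rcases hn' with h | h <;> simp [h]
    have h0 : 0 < (|n| : ℝ) := by
      by_contra! h
      nlinarith [hs.1]
    have h1 : (1 : ℝ) ≤ |(n : ℝ)| := by
      have : n ≠ 0 := by rintro rfl; simp at h0
      exact_mod_cast Int.one_le_abs this
    nlinarith [hs.2]
  · have hcirc := AddCircle.coe_image_Icc_eq β 0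
    ext ⟨w, θ⟩
    simp only [mem_prod, mem_singleton_iff, mem_univ, and_true, mem_image, Prod.mk.injEq]
    constructor
    · rintro rfl
      rw [zero_add] at hcirc
      rcases hσ w with h | h
      · obtain ⟨r, hr, hrθ⟩ := (hcirc.symm ▸ mem_univ θ : θ ∈ _)
        exact ⟨r, hr, rfl, by simpa [h] using hrθ⟩
      · obtain ⟨r, hr, hrθ⟩ := (hcirc.symm ▸ mem_univ (-θ) : -θ ∈ _)
        exact ⟨r, hr, rfl, by rw [h, neg_one_mul, AddCircle.coe_neg, hrθ, neg_neg]⟩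
    · rintro ⟨r, -, rfl, -⟩
      rfl

/-- If no bridge touches the vertices of `W`, there are exactly `|W|` trajectories above `W`. -/
theorem ncard_supportsAbove_of_no_bridge (hβ : 0 < β) (hσ : ∀ v, σ v = 1 ∨ σ v = -1)
    (W : Finset V) (hW : ∀ v ∈ W, ∀ z t, (s(v, z), t) ∉ B) :
    (supportsAbove σ B (W : Set V)).ncard = W.card := by
  have : supportsAbove σ B (W : Set V) =
      (fun v : V => ({v} ×ˢ univ : Set (V × AddCircle β))) '' (W : Set V) := by
    -- trajectories above `W` see no bridge, so the empty set of bridges may be used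
    rw [supportsAbove_congr (B' := ∅) (fun a b t ha => by simp [hW a ha b t])]
    have hmatch : IsMatched (∅ : Set (Sym2 V × AddCircle β)) := fun _ _ _ _ h => absurd h (by simp)
    ext S
    constructor
    · rintro ⟨hS, hSW⟩
      obtain ⟨p, hp⟩ := nonempty_of_mem_trajectorySupports hS
      exact ⟨p.1, hSW hp, eq_of_mem_trajectorySupports hmatch
        (vertical_mem_trajectorySupports hβ hσ (by simp)) hS (p := p) (by simp) hp⟩
    · rintro ⟨v, hv, rfl⟩
      refine ⟨vertical_mem_trajectorySupports hβ hσ (by simp), ?_⟩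
      rintro ⟨w, θ⟩ hw
      simp only [mem_prod, mem_singleton_iff, mem_univ, and_true] at hw
      exact hw ▸ hv
  rw [this, ncard_image_of_injective, ncard_coe_finset]
  intro v w hvw
  have : ((v, 0) : V × AddCircle β) ∈ ({w} ×ˢ univ : Set (V × AddCircle β)) := by
    rw [← show ({v} ×ˢ univ : Set (V × AddCircle β)) = {w} ×ˢ univ from hvw]; simp
  simpa using this

/-- The trajectories above a set that no bridge leaves, and those above its complement, make up all
trajectories. -/
theorem ncard_trajectorySupports_eq_add {W : Set V}
    (hW : ∀ a b t, (s(a, b), t) ∈ B → (a ∈ W ↔ b ∈ W))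
    (hfin : (trajectorySupports σ B).Finite) :
    (trajectorySupports σ B).ncard =
      (supportsAbove σ B W).ncard + (supportsAbove σ B Wᶜ).ncard := by
  rw [← ncard_union_eq _ (hfin.subset fun S hS => hS.1) (hfin.subset fun S hS => hS.1)]
  · congr 1
    ext S
    refine ⟨fun hS => ?_, fun hS => hS.elim (fun h => h.1) (fun h => h.1)⟩
    obtain ⟨p, hp⟩ := nonempty_of_mem_trajectorySupports hS
    by_cases hpW : p.1 ∈ W
    · exact Or.inl ⟨hS, subset_of_mem_trajectorySupports (fun a b t h => (hW a b t h).1) hS hp hpW⟩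
    · exact Or.inr ⟨hS, subset_of_mem_trajectorySupports (W := Wᶜ)
        (fun a b t h ha hb => ha ((hW a b t h).2 hb)) hS hp hpW⟩
  · rw [Set.disjoint_left]
    rintro S hS hS'
    obtain ⟨p, hp⟩ := nonempty_of_mem_trajectorySupports hS.1
    exact hS'.2 hp (hS.2 hp)

theorem supportsAbove_univ : supportsAbove σ B univ = trajectorySupports σ B := by
  simp [supportsAbove]

end Count

/-! ### Counting clusters of edges -/

section Cluster

variable {V : Type*} [Fintype V] [DecidableEq V]

open Classical in
/-- The vertices that are connected to `D` by the edges of `F`: the smallest set of vertices that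
contains `D` and that no edge of `F` leaves. -/
noncomputable def cluster (D : Finset V) (F : Finset (Sym2 V)) : Finset V :=
  {v | ∀ C : Finset V, D ⊆ C → (∀ a b, s(a, b) ∈ F → a ∈ C → b ∈ C) → v ∈ C}

/-- Every edge of `F` is connected to `D` within `F`. -/
def IsClusterSet (D : Finset V) (F : Finset (Sym2 V)) : Prop :=
  ∀ e ∈ F, ∃ a ∈ e, a ∈ cluster D F

theorem mem_cluster {D : Finset V} {F : Finset (Sym2 V)} {v : V} :
    v ∈ cluster D F ↔
      ∀ C : Finset V, D ⊆ C → (∀ a b, s(a, b) ∈ F → a ∈ C → b ∈ C) → v ∈ C := by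
  simp [cluster]

theorem subset_cluster (D : Finset V) (F : Finset (Sym2 V)) : D ⊆ cluster D F :=
  fun _ hv => mem_cluster.2 fun _ hD _ => hD hv

theorem cluster_closed {D : Finset V} {F : Finset (Sym2 V)} {a b : V} (hab : s(a, b) ∈ F)
    (ha : a ∈ cluster D F) : b ∈ cluster D F :=
  mem_cluster.2 fun C hD hC => hC a b hab (mem_cluster.1 ha C hD hC)

theorem cluster_insert {D : Finset V} (F : Finset (Sym2 V)) {v : V} (hv : v ∈ D) (u : V) :
    cluster D (insert s(v, u) F) = cluster (insert u D) F := by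
  ext y
  rw [mem_cluster, mem_cluster]
  refine forall_congr' fun C => ⟨fun h hD hC => h (fun d hd => hD (by simp [hd])) ?_,
    fun h hD hC => h ?_ fun a b hab => hC a b (by simp [hab])⟩
  · intro a b hab ha
    rcases Finset.mem_insert.1 hab with h' | h'
    · rcases Sym2.eq_iff.1 h' with ⟨rfl, rfl⟩ | ⟨rfl, rfl⟩
      · exact hD (by simp)
      · exact hD (by simp [hv])
    · exact hC a b h' ha
  · exact Finset.insert_subset (hC v u (by simp) (hD hv)) hD

theorem isClusterSet_insert {D : Finset V} (F : Finset (Sym2 V)) {v : V} (hv : v ∈ D) (u : V) :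
    IsClusterSet D (insert s(v, u) F) ↔ IsClusterSet (insert u D) F := by
  unfold IsClusterSet
  rw [cluster_insert F hv]
  refine ⟨fun h e he => h e (by simp [he]), fun h e he => ?_⟩
  rcases Finset.mem_insert.1 he with rfl | he
  · exact ⟨v, by simp, subset_cluster _ _ (by simp [hv])⟩
  · exact h e he

/-- The edges of `O` that touch the cluster of `D` have the same cluster as `O`. -/
theorem cluster_filter (D : Finset V) (O : Finset (Sym2 V))
    [DecidablePred fun e : Sym2 V => ∃ a ∈ e, a ∈ cluster D O] :
    cluster D {e ∈ O | ∃ a ∈ e, a ∈ cluster D O} = cluster D O := by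
  ext v
  constructor
  · exact fun hv => mem_cluster.1 hv _ (subset_cluster D O)
      fun a b hab => cluster_closed (Finset.mem_filter.1 hab).1
  · refine fun hv => mem_cluster.2 fun C hD hC => ?_
    refine (Finset.mem_inter.1 (mem_cluster.1 hv (C ∩ cluster D O)
      (Finset.subset_inter hD (subset_cluster D O)) fun a b hab ha => ?_)).1
    rw [Finset.mem_inter] at ha ⊢
    exact ⟨hC a b (Finset.mem_filter.2 ⟨hab, a, by simp, ha.2⟩) ha.1, cluster_closed hab ha.2⟩

theorem isClusterSet_filter (D : Finset V) (O : Finset (Sym2 V))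
    [DecidablePred fun e : Sym2 V => ∃ a ∈ e, a ∈ cluster D O] :
    IsClusterSet D {e ∈ O | ∃ a ∈ e, a ∈ cluster D O} := by
  intro e he
  rw [cluster_filter]
  exact (Finset.mem_filter.1 he).2

open Classical in
/-- The generating function of the clusters of `D` in the set of edges `U`: an edge carries the
weight `w` and a vertex outside `D` carries the weight `z`. It is bounded by exploring the cluster
edge by edge. Each pair of an explored vertex and an unexplored edge at it contributes a
factor `φ`. An edge between two explored vertices uses up two such pairs; an edge to a new vertex
uses up one pair and creates at most `κ - 1` new ones. -/
theorem sum_isClusterSet_le {κ : ℕ} {φ w z : ℝ} (hφ : 1 ≤ φ) (hw : 0 ≤ w) (hz : 0 ≤ z)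
    (h1 : 1 + w ≤ φ ^ 2) (h2 : 1 + w * z * φ ^ (κ - 1) ≤ φ) :
    ∀ (n : ℕ) (U : Finset (Sym2 V)), U.card = n → (∀ e ∈ U, ¬ e.IsDiag) →
      (∀ v, ({e ∈ U | v ∈ e} : Finset _).card ≤ κ) → ∀ D : Finset V,
      ∑ F ∈ U.powerset, (if IsClusterSet D F then
        w ^ F.card * z ^ ((cluster D F).card - D.card) else 0) ≤
      φ ^ (∑ v ∈ D, ({e ∈ U | v ∈ e} : Finset _).card) := by
  intro n
  induction n with
  | zero =>
    intro U hU _ _ D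
    obtain rfl := Finset.card_eq_zero.1 hU
    have hD : cluster D ∅ = D := Finset.Subset.antisymm
      (fun v hv => mem_cluster.1 hv D subset_rfl (by simp)) (subset_cluster D ∅)
    simp [IsClusterSet, hD]
  | succ n ih =>
    intro U hU hdiag hdeg D
    by_cases hex : ∃ e ∈ U, ∃ v ∈ D, v ∈ e
    · obtain ⟨e, heU, v, hvD, hve⟩ := hex
      obtain ⟨u, rfl⟩ := Sym2.mem_iff_exists.1 hve
      obtain ⟨U', hU', rfl⟩ : ∃ U', s(v, u) ∉ U' ∧ insert s(v, u) U' = U :=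
        ⟨U.erase s(v, u), by simp, Finset.insert_erase heU⟩
      have hvu : v ≠ u := by simpa using hdiag _ heU
      have hcard : U'.card = n := by
        rw [Finset.card_insert_of_notMem hU'] at hU
        omega
      have hdegins : ∀ y, ({e ∈ insert s(v, u) U' | y ∈ e} : Finset _).card =
          ({e ∈ U' | y ∈ e} : Finset _).card + if y ∈ s(v, u) then 1 else 0 := by
        intro y
        rw [Finset.filter_insert]
        split_ifs with h
        · rw [Finset.card_insert_of_notMem (by simp [hU'])]
        · simp
      have ih' := ih U' hcard (fun e he => hdiag e (by simp [he]))
        (fun y => le_trans (by rw [hdegins]; omega) (hdeg y))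
      rw [Finset.sum_powerset_insert hU']
      have hins : ∀ F ∈ U'.powerset, (if IsClusterSet D (insert s(v, u) F) then
          w ^ (insert s(v, u) F).card *
            z ^ ((cluster D (insert s(v, u) F)).card - D.card) else 0) =
          w * z ^ ((insert u D).card - D.card) * (if IsClusterSet (insert u D) F then
            w ^ F.card * z ^ ((cluster (insert u D) F).card - (insert u D).card) else 0) := by
        intro F hF
        have hF' : s(v, u) ∉ F := fun h => hU' (Finset.mem_powerset.1 hF h)
        rw [isClusterSet_insert F hvD, cluster_insert F hvD, Finset.card_insert_of_notMem hF']
        split_ifs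
        · have c1 := Finset.card_le_card (subset_cluster (insert u D) F)
          have c2 := Finset.card_le_card (Finset.subset_insert u D)
          rw [show (cluster (insert u D) F).card - D.card = ((insert u D).card - D.card) +
            ((cluster (insert u D) F).card - (insert u D).card) by omega, pow_add, pow_succ]
          ring
        · simp
      rw [Finset.sum_congr rfl hins, ← Finset.mul_sum]
      have hsumv : ∀ D' : Finset V, ∑ y ∈ D', ({e ∈ insert s(v, u) U' | y ∈ e} : Finset _).card =
          ∑ y ∈ D', ({e ∈ U' | y ∈ e} : Finset _).card +
            ({y ∈ D' | y ∈ s(v, u)} : Finset _).card := by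
        intro D'
        rw [Finset.sum_congr rfl fun y _ => hdegins y, Finset.sum_add_distrib, Finset.card_filter]
      set S := ∑ y ∈ D, ({e ∈ U' | y ∈ e} : Finset _).card with hS
      rw [hsumv]
      have hS0 : 0 ≤ φ ^ S := by positivity
      by_cases hu : u ∈ D
      · -- an edge between two explored vertices
        have hfil : ({y ∈ D | y ∈ s(v, u)} : Finset V) = {v, u} := by
          ext y
          simp only [Finset.mem_filter, Sym2.mem_iff, Finset.mem_insert, Finset.mem_singleton]
          constructor
          · exact fun h => h.2
          · rintro (rfl | rfl)
            · exact ⟨hvD, Or.inl rfl⟩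
            · exact ⟨hu, Or.inr rfl⟩
        rw [hfil, Finset.card_pair hvu, Finset.insert_eq_self.2 hu]
        simp only [Nat.sub_self, pow_zero, mul_one]
        calc _ ≤ φ ^ S + w * φ ^ S :=
              add_le_add (ih' D) (mul_le_mul_of_nonneg_left (ih' D) hw)
          _ = (1 + w) * φ ^ S := by ring
          _ ≤ φ ^ 2 * φ ^ S := mul_le_mul_of_nonneg_right h1 hS0
          _ = φ ^ (S + 2) := by ring
      · -- an edge to a new vertex
        have hfil : ({y ∈ D | y ∈ s(v, u)} : Finset V) = {v} := by
          ext y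
          simp only [Finset.mem_filter, Sym2.mem_iff, Finset.mem_singleton]
          constructor
          · rintro ⟨hy, rfl | rfl⟩
            · rfl
            · exact absurd hy hu
          · rintro rfl
            exact ⟨hvD, Or.inl rfl⟩
        have hdegu : ({e ∈ U' | u ∈ e} : Finset _).card ≤ κ - 1 := by
          have := hdeg u
          rw [hdegins, if_pos (by simp)] at this
          omega
        have hnew := ih' (insert u D)
        rw [Finset.sum_insert hu, ← hS] at hnew
        rw [hfil, Finset.card_singleton, Finset.card_insert_of_notMem hu, Nat.add_sub_cancel_left,
          pow_one]
        have hnew' := hnew.trans (pow_le_pow_right₀ hφ (Nat.add_le_add_right hdegu S))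
        rw [Finset.card_insert_of_notMem hu] at hnew'
        calc _ ≤ φ ^ S + w * z * φ ^ (κ - 1 + S) :=
              add_le_add (ih' D) (mul_le_mul_of_nonneg_left hnew' (by positivity))
          _ = (1 + w * z * φ ^ (κ - 1)) * φ ^ S := by ring
          _ ≤ φ * φ ^ S := mul_le_mul_of_nonneg_right h2 hS0
          _ = φ ^ (S + 1) := by ring
    · -- no edge touches `D`: the empty set is the only cluster
      push Not at hex
      have hone : ∀ F ∈ U.powerset, (if IsClusterSet D F then
          w ^ F.card * z ^ ((cluster D F).card - D.card) else 0) = if F = ∅ then 1 else 0 := by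
        intro F hF
        have hFU := Finset.mem_powerset.1 hF
        have hcl : cluster D F = D := Finset.Subset.antisymm
          (fun v hv => mem_cluster.1 hv D subset_rfl fun a b hab ha =>
            absurd (by simp) (hex _ (hFU hab) a ha)) (subset_cluster D F)
        by_cases hF0 : F = ∅
        · subst hF0
          simp [hcl, IsClusterSet]
        · rw [if_neg hF0, if_neg]
          intro h
          obtain ⟨e, he⟩ := Finset.nonempty_iff_ne_empty.2 hF0
          obtain ⟨a, hae, ha⟩ := h e he
          exact hex e (hFU he) a (hcl ▸ ha) hae
      rw [Finset.sum_congr rfl hone, Finset.sum_ite_eq' U.powerset ∅ fun _ => (1 : ℝ)]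
      simp only [Finset.empty_mem_powerset, if_true]
      exact one_le_pow₀ hφ

end Cluster

/-! ### The Poisson process on one edge -/

section Poisson

theorem measurable_timeList_iff {X : Type*} [MeasurableSpace X] {f : TimeList → X} :
    Measurable f ↔ ∀ n, Measurable fun t : Fin n → ℝ => f ⟨n, t⟩ := by
  refine ⟨fun h n => h.comp ?_, fun h s hs => ?_⟩
  · intro s hs
    exact (MeasurableSpace.measurableSet_iInf.1 hs) n
  · exact MeasurableSpace.measurableSet_iInf.2 fun n => h n hs

theorem measurable_timeList_fst : Measurable (fun t : TimeList => t.1) :=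
  measurable_timeList_iff.2 fun _ => measurable_const

theorem measurable_timeList_mk (n : ℕ) : Measurable fun t : Fin n → ℝ => (⟨n, t⟩ : TimeList) :=
  measurable_timeList_iff.1 measurable_id n

theorem lintegral_poissonTimes {f : TimeList → ℝ≥0∞} (hf : Measurable f) (β : ℝ) :
    ∫⁻ t, f t ∂(poissonTimes β) = ∑' n : ℕ, ENNReal.ofReal (Real.exp (-β) / (n.factorial : ℝ)) *
      ∫⁻ t : Fin n → ℝ, f ⟨n, t⟩ ∂(Measure.pi fun _ => (volume : Measure ℝ).restrict (Icc 0 β)) := by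
  rw [poissonTimes, lintegral_sum_measure]
  congr 1; ext n
  rw [lintegral_smul_measure, lintegral_map hf (measurable_timeList_mk n), smul_eq_mul]

theorem lintegral_poissonTimes_fst {β : ℝ} (hβ : 0 < β) (g : ℕ → ℝ≥0∞) :
    ∫⁻ t, g t.1 ∂(poissonTimes β) =
      ∑' n : ℕ, ENNReal.ofReal (Real.exp (-β) * (β ^ n / (n.factorial : ℝ))) * g n := by
  have hm : Measurable fun t : TimeList => g t.1 :=
    (measurable_of_countable g).comp measurable_timeList_fst
  rw [lintegral_poissonTimes hm]
  refine tsum_congr fun n => ?_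
  simp only []
  rw [lintegral_const, Measure.pi_univ]
  simp only [Measure.restrict_apply MeasurableSet.univ, univ_inter, Real.volume_Icc, sub_zero,
    Finset.prod_const, Finset.card_univ, Fintype.card_fin]
  rw [mul_comm (g n), ← mul_assoc, ← ENNReal.ofReal_pow hβ.le, ← ENNReal.ofReal_mul (by positivity)]
  congr 2; ring

theorem lintegral_poissonTimes_pow {β q : ℝ} (hβ : 0 < β) (hq : 0 ≤ q) :
    ∫⁻ t, ENNReal.ofReal q ^ t.1 ∂(poissonTimes β) =
      ENNReal.ofReal (Real.exp (-β) * Real.exp (β * q)) := by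
  rw [lintegral_poissonTimes_fst hβ]
  have h : ∀ n : ℕ, ENNReal.ofReal (Real.exp (-β) * (β ^ n / (n.factorial : ℝ))) *
      ENNReal.ofReal q ^ n = ENNReal.ofReal (Real.exp (-β) * ((β * q) ^ n / n.factorial)) := by
    intro n
    rw [← ENNReal.ofReal_pow hq, ← ENNReal.ofReal_mul (by positivity)]
    congr 1; rw [mul_pow]; ring
  have hs : HasSum (fun n : ℕ => Real.exp (-β) * ((β * q) ^ n / n.factorial))
      (Real.exp (-β) * Real.exp (β * q)) := by
    have := (NormedSpace.expSeries_div_hasSum_exp (β * q)).mul_left (Real.exp (-β))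
    rwa [← Real.exp_eq_exp_ℝ] at this
  rw [tsum_congr h, ← ENNReal.ofReal_tsum_of_nonneg (fun n => by positivity) hs.summable,
    hs.tsum_eq]

theorem isProbabilityMeasure_poissonTimes {β : ℝ} (hβ : 0 < β) :
    IsProbabilityMeasure (poissonTimes β) := by
  have h := lintegral_poissonTimes_pow hβ zero_le_one
  simp only [ENNReal.ofReal_one, one_pow, lintegral_const, one_mul, mul_one] at h
  rw [← Real.exp_add, neg_add_cancel, Real.exp_zero, ENNReal.ofReal_one] at h
  exact ⟨h⟩

/-- The realisation without points. -/
def noTimes : TimeList := ⟨0, Fin.elim0⟩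

theorem eq_noTimes_iff {t : TimeList} : t = noTimes ↔ t.1 = 0 := by
  constructor
  · rintro rfl; rfl
  · obtain ⟨n, t⟩ := t
    rintro rfl
    exact congrArg _ (Subsingleton.elim _ _)

theorem measurableSet_fst_eq_zero : MeasurableSet {t : TimeList | t.1 = 0} :=
  measurable_timeList_fst (measurableSet_singleton 0)

theorem poissonTimes_noTimes {β : ℝ} (hβ : 0 < β) :
    poissonTimes β {noTimes} = ENNReal.ofReal (Real.exp (-β)) := by
  have hset : ({noTimes} : Set TimeList) = {t | t.1 = 0} := by
    ext t; simp [eq_noTimes_iff]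
  rw [hset, ← lintegral_indicator_one measurableSet_fst_eq_zero]
  have := lintegral_poissonTimes_fst hβ (fun n => if n = 0 then 1 else 0)
  rw [tsum_eq_single 0 (by intro n hn; simp [hn])] at this
  simpa [indicator] using this

theorem lintegral_poissonTimes_pow_ne_zero {β q : ℝ} (hβ : 0 < β) (hq : 0 ≤ q) :
    ∫⁻ t in {t | t.1 ≠ 0}, ENNReal.ofReal q ^ t.1 ∂(poissonTimes β) =
      ENNReal.ofReal (Real.exp (β * q) - 1) * ENNReal.ofReal (Real.exp (-β)) := by
  have hm : Measurable fun t : TimeList => ENNReal.ofReal q ^ t.1 :=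
    (measurable_of_countable fun n : ℕ => ENNReal.ofReal q ^ n).comp measurable_timeList_fst
  have h := lintegral_add_compl (μ := poissonTimes β) (fun t => ENNReal.ofReal q ^ t.1)
    measurableSet_fst_eq_zero
  rw [lintegral_poissonTimes_pow hβ hq] at h
  have h0 : ∫⁻ t in {t : TimeList | t.1 = 0}, ENNReal.ofReal q ^ t.1 ∂(poissonTimes β) =
      ENNReal.ofReal (Real.exp (-β)) := by
    rw [setLIntegral_congr_fun (g := fun _ => 1) measurableSet_fst_eq_zero
      (fun t ht => by simp [show t.1 = 0 from ht]), setLIntegral_one, ← poissonTimes_noTimes hβ]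
    congr 1; ext t; simp [eq_noTimes_iff]
  rw [h0] at h
  have hc : {t : TimeList | t.1 ≠ 0} = {t : TimeList | t.1 = 0}ᶜ := rfl
  rw [hc, ← ENNReal.ofReal_mul (by
    have : 1 ≤ Real.exp (β * q) := Real.one_le_exp (by positivity)
    linarith)]
  refine (ENNReal.add_right_inj ENNReal.ofReal_ne_top).1 (h.trans ?_)
  rw [← ENNReal.ofReal_add (by positivity)]
  · congr 1; ring
  · have : 1 ≤ Real.exp (β * q) := Real.one_le_exp (by positivity)
    exact mul_nonneg (by linarith) (by positivity)

/-- The `i`-th point, with the value `0` if there are not so many points. -/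
def timeAt (i : ℕ) (t : TimeList) : ℝ := if h : i < t.1 then t.2 ⟨i, h⟩ else 0

theorem measurable_timeAt (i : ℕ) : Measurable (timeAt i) := by
  refine measurable_timeList_iff.2 fun n => ?_
  by_cases h : i < n
  · simpa [timeAt, h] using measurable_pi_apply (X := fun _ : Fin n => ℝ) ⟨i, h⟩
  · simp [timeAt, h]

/-- A given time is almost surely not a point of the process. -/
theorem poissonTimes_timeAt_eq (β : ℝ) (i : ℕ) (c : ℝ) :
    poissonTimes β {t | i < t.1 ∧ timeAt i t = c} = 0 := by
  have hmeas : MeasurableSet {t : TimeList | i < t.1 ∧ timeAt i t = c} :=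
    (measurable_timeList_fst measurableSet_Ioi).inter
      (measurable_timeAt i (measurableSet_singleton c))
  rw [poissonTimes, Measure.sum_apply _ hmeas, ENNReal.tsum_eq_zero]
  intro n
  rw [Measure.smul_apply, Measure.map_apply (measurable_timeList_mk n) hmeas, smul_eq_mul]
  refine mul_eq_zero_of_right _ ?_
  by_cases h : i < n
  · have : (fun t : Fin n → ℝ => (⟨n, t⟩ : TimeList)) ⁻¹' {t | i < t.1 ∧ timeAt i t = c} =
        {t | t ⟨i, h⟩ = c} := by
      ext t; simp [timeAt, h]
    rw [this]
    exact Measure.pi_hyperplane _ _ _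
  · have : (fun t : Fin n → ℝ => (⟨n, t⟩ : TimeList)) ⁻¹' {t | i < t.1 ∧ timeAt i t = c} = ∅ := by
      ext t; simp [h]
    rw [this, measure_empty]

/-- Points of two independent processes almost surely do not differ by a given number. -/
theorem prod_poissonTimes_timeAt_eq {β : ℝ} (hβ : 0 < β) (i j : ℕ) (c : ℝ) :
    ((poissonTimes β).prod (poissonTimes β))
      {p | i < p.1.1 ∧ j < p.2.1 ∧ timeAt j p.2 = timeAt i p.1 + c} = 0 := by
  have := isProbabilityMeasure_poissonTimes hβ
  have hmeas : MeasurableSet {p : TimeList × TimeList |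
      i < p.1.1 ∧ j < p.2.1 ∧ timeAt j p.2 = timeAt i p.1 + c} :=
    ((measurable_timeList_fst.comp measurable_fst) measurableSet_Ioi).inter
      (((measurable_timeList_fst.comp measurable_snd) measurableSet_Ioi).inter
        (measurableSet_eq_fun ((measurable_timeAt j).comp measurable_snd)
          (((measurable_timeAt i).comp measurable_fst).add_const c)))
  rw [Measure.measure_prod_null hmeas]
  refine Filter.Eventually.of_forall fun t => ?_
  refine measure_mono_null ?_ (poissonTimes_timeAt_eq β j (timeAt i t + c))
  exact fun s hs => ⟨hs.2.1, hs.2.2⟩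

theorem lintegral_pi_prod {ι : Type*} [Fintype ι] {Ω : Type*} [MeasurableSpace Ω] (μ : Measure Ω)
    [IsProbabilityMeasure μ] {g : Ω → ℝ≥0∞} (hg : Measurable g) :
    ∫⁻ t, ∏ i, g (t i) ∂(Measure.pi fun _ : ι => μ) = (∫⁻ t, g t ∂μ) ^ Fintype.card ι := by
  have hind : ProbabilityTheory.iIndepFun (fun (i : ι) (t : ι → Ω) => g (t i))
      (Measure.pi fun _ : ι => μ) :=
    ProbabilityTheory.iIndepFun_pi fun _ => hg.aemeasurable
  rw [ProbabilityTheory.lintegral_prod_eq_prod_lintegral_of_indepFun Finset.univ _ hind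
    fun i => hg.comp (measurable_pi_apply i)]
  have : ∀ i : ι, ∫⁻ t, g (t i) ∂(Measure.pi fun _ : ι => μ) = ∫⁻ t, g t ∂μ := fun i =>
    (measurePreserving_eval (fun _ : ι => μ) i).lintegral_comp hg
  simp [this]

/-- The weight of a family of edges that all carry points. -/
theorem setLIntegral_pi_poissonTimes {ι : Type*} [Fintype ι] {β q : ℝ} (hβ : 0 < β) (hq : 0 ≤ q) :
    ∫⁻ t in {t : ι → TimeList | ∀ i, (t i).1 ≠ 0}, ∏ i, ENNReal.ofReal q ^ (t i).1
      ∂(Measure.pi fun _ : ι => poissonTimes β) =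
      ENNReal.ofReal (Real.exp (β * q) - 1) ^ Fintype.card ι *
        ENNReal.ofReal (Real.exp (-β)) ^ Fintype.card ι := by
  have := isProbabilityMeasure_poissonTimes hβ
  have hm : Measurable fun t : TimeList => ENNReal.ofReal q ^ t.1 :=
    (measurable_of_countable fun n : ℕ => ENNReal.ofReal q ^ n).comp measurable_timeList_fst
  have hs : MeasurableSet {t : TimeList | t.1 ≠ 0} := measurableSet_fst_eq_zero.compl
  have hS : MeasurableSet {t : ι → TimeList | ∀ i, (t i).1 ≠ 0} := by
    rw [ofPred_forall]
    exact MeasurableSet.iInter fun i => hs.preimage (measurable_pi_apply i)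
  rw [← mul_pow, ← lintegral_poissonTimes_pow_ne_zero hβ hq, ← lintegral_indicator hs,
    ← lintegral_pi_prod _ (hm.indicator hs), ← lintegral_indicator hS]
  congr 1; ext t
  by_cases h : ∀ i, (t i).1 ≠ 0
  · rw [indicator_of_mem (show t ∈ {t : ι → TimeList | ∀ i, (t i).1 ≠ 0} from h)]
    exact Finset.prod_congr rfl fun i _ => 
      (indicator_of_mem (s := {t : TimeList | t.1 ≠ 0}) (h i) fun t => ENNReal.ofReal q ^ t.1).symm
  · rw [indicator_of_notMem (by simpa using h)]
    push Not at h
    obtain ⟨i, hi⟩ := h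
    exact (Finset.prod_eq_zero (Finset.mem_univ i) 
      (indicator_of_notMem (s := {t : TimeList | t.1 ≠ 0}) (fun h => h hi) _)).symm

end Poisson

/-! ### The Poisson edge process -/

section EdgeProcess

variable {V : Type*} [Fintype V] [DecidableEq V] (G : SimpleGraph V) [DecidableRel G.Adj]

theorem isProbabilityMeasure_poissonEdge {β : ℝ} (hβ : 0 < β) :
    IsProbabilityMeasure (poissonEdge G β) := by
  have := isProbabilityMeasure_poissonTimes hβ
  unfold poissonEdge
  infer_instance

/-- Bridges on different edges almost surely occur at different times. -/
theorem ae_isMatched {β : ℝ} (hβ : 0 < β) :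
    ∀ᵐ ω ∂(poissonEdge G β), IsMatched (bridges β ω) := by
  have := isProbabilityMeasure_poissonTimes hβ
  have key : ∀ e e' : G.edgeSet, e ≠ e' → ∀ (i j : ℕ) (m : ℤ), ∀ᵐ ω ∂(poissonEdge G β),
      ¬ (i < (ω e).1 ∧ j < (ω e').1 ∧ timeAt j (ω e') = timeAt i (ω e) + m * β) := by
    intro e e' hne i j m
    have hind : ProbabilityTheory.IndepFun (fun ω : EdgeConfig G => ω e) (fun ω => ω e')
        (poissonEdge G β) :=
      (ProbabilityTheory.iIndepFun_pi (X := fun (_ : G.edgeSet) (t : TimeList) => t)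
        (μ := fun _ => poissonTimes β) fun _ => aemeasurable_id).indepFun hne
    have hmap : ∀ e : G.edgeSet, (poissonEdge G β).map (fun ω => ω e) = poissonTimes β := fun e =>
      (measurePreserving_eval (fun _ : G.edgeSet => poissonTimes β) e).map_eq
    have := isProbabilityMeasure_poissonEdge G hβ
    rw [ProbabilityTheory.indepFun_iff_map_prod_eq_prod_map_map
      (measurable_pi_apply e).aemeasurable (measurable_pi_apply e').aemeasurable, hmap, hmap] at hind
    have h0 := prod_poissonTimes_timeAt_eq hβ i j (m * β)
    rw [← hind] at h0
    have hae : ∀ᵐ p ∂((poissonEdge G β).map fun ω => (ω e, ω e')),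
        ¬ (i < p.1.1 ∧ j < p.2.1 ∧ timeAt j p.2 = timeAt i p.1 + m * β) := by
      rw [ae_iff]
      simpa only [not_not] using h0
    exact ae_of_ae_map ((measurable_pi_apply e).prodMk (measurable_pi_apply e')).aemeasurable hae
  have key' : ∀ᵐ ω ∂(poissonEdge G β), ∀ e e' : G.edgeSet, e ≠ e' → ∀ (i j : ℕ) (m : ℤ),
      ¬ (i < (ω e).1 ∧ j < (ω e').1 ∧ timeAt j (ω e') = timeAt i (ω e) + m * β) := by
    simp only [ae_all_iff]
    exact key
  filter_upwards [key'] with ω hω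
  rintro x y z t ⟨e, i, hei⟩ ⟨e', j, hej⟩
  rw [Prod.mk.injEq] at hei hej
  by_cases hne : e = e'
  · subst hne
    exact Sym2.congr_right.1 (hei.1.trans hej.1.symm)
  · have heq := hei.2.symm.trans hej.2
    rw [eq_comm, ← sub_eq_zero, ← AddCircle.coe_sub, AddCircle.coe_eq_zero_iff] at heq
    obtain ⟨m, hm⟩ := heq
    refine absurd ⟨i.2, j.2, ?_⟩ (hω e e' hne i j m)
    simp only [timeAt, i.2, j.2, dif_pos, Fin.eta]
    rw [zsmul_eq_mul] at hm
    linarith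

end EdgeProcess

/-! ### Densities on product spaces -/

section Density

/-- A bound on the mass of a set under a density that factorizes on `univ ×ˢ M₂`. Neither the density
nor the set has to be measurable: lower integrals are bounded by iterated lower integrals, and `f₁`
may be replaced by a measurable minorant with the same integrals. -/
theorem withDensity_prod_mul_le {Ω₁ Ω₂ : Type*} [MeasurableSpace Ω₁] [MeasurableSpace Ω₂]
    (μ₁ : Measure Ω₁) (μ₂ : Measure Ω₂) [IsProbabilityMeasure μ₁] [IsProbabilityMeasure μ₂]
    {f : Ω₁ × Ω₂ → ℝ≥0∞} {f₁ g : Ω₁ → ℝ≥0∞} {h : Ω₂ → ℝ≥0∞} {c : ℝ≥0∞} {ω₀ : Ω₁}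
    {M₁ : Set Ω₁} {M₂ : Set Ω₂} {S : Set (Ω₁ × Ω₂)}
    (hω₀ : MeasurableSet {ω₀}) (hM₁ : MeasurableSet M₁) (hM₂ : MeasurableSet M₂)
    (hg : Measurable g) (hf₁ : ∀ ω, f₁ ω ≠ ∞) (hc : c ≠ 0) (hμ : μ₁ {ω₀} ≠ 0)
    (hZ : ∫⁻ p, f p ∂(μ₁.prod μ₂) ≠ ∞)
    (hf : ∀ᵐ p ∂(μ₁.prod μ₂), p.2 ∈ M₂ → f p = f₁ p.1 * h p.2)
    (hf₀ : ∀ᵐ p ∂(μ₁.prod μ₂), p.1 = ω₀ → p.2 ∈ M₂ → f p = c * h p.2)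
    (hS : ∀ᵐ p ∂(μ₁.prod μ₂), p ∈ S → p.1 ∈ M₁ ∧ p.2 ∈ M₂ ∧ f₁ p.1 ≤ g p.1) :
    (μ₁.prod μ₂).withDensity f S * (μ₁ {ω₀} * c) ≤
      (∫⁻ ω in M₁, g ω ∂μ₁) * ∫⁻ p, f p ∂(μ₁.prod μ₂) := by
  set H : ℝ≥0∞ := ∫⁻ ω in M₂, h ω ∂μ₂ with hH
  have hlow : μ₁ {ω₀} * c * H ≤ ∫⁻ p, f p ∂(μ₁.prod μ₂) := by
    obtain ⟨h', hm, hle, hint⟩ := exists_measurable_le_forall_setLIntegral_eq μ₂ h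
    calc μ₁ {ω₀} * c * H
        = ∫⁻ p, c * h' p.2 ∂((μ₁.restrict {ω₀}).prod (μ₂.restrict M₂)) := by
          rw [lintegral_prod_mul (f := fun _ => c) aemeasurable_const hm.aemeasurable,
            setLIntegral_const, ← hint, ← hH, mul_comm c]
      _ = ∫⁻ p in {ω₀} ×ˢ M₂, c * h' p.2 ∂(μ₁.prod μ₂) := by rw [Measure.prod_restrict]
      _ ≤ ∫⁻ p in {ω₀} ×ˢ M₂, f p ∂(μ₁.prod μ₂) := by
          refine lintegral_mono_ae ((ae_restrict_iff' (hω₀.prod hM₂)).2 ?_)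
          filter_upwards [hf₀] with p hp hpm
          rw [hp hpm.1 hpm.2]
          exact mul_le_mul_right (hle p.2) c
      _ ≤ _ := setLIntegral_le_lintegral _ _
  have hHtop : H ≠ ∞ := by
    intro h
    rw [h, ENNReal.mul_top (mul_ne_zero hμ hc)] at hlow
    exact hZ (top_le_iff.1 hlow)
  obtain ⟨f₁', hm, hle, hint⟩ := exists_measurable_le_forall_setLIntegral_eq μ₁ f₁
  set T : Set Ω₁ := M₁ ∩ {ω | f₁' ω ≤ g ω} with hT
  have hTm : MeasurableSet T := hM₁.inter (measurableSet_le hm hg)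
  have hST : (μ₁.prod μ₂).withDensity f S ≤ (μ₁.prod μ₂).withDensity f (T ×ˢ M₂) := by
    refine measure_mono_ae ?_
    filter_upwards [(withDensity_absolutelyContinuous (μ₁.prod μ₂) f).ae_le hS] with p hp hpS
    obtain ⟨h1, h2, h3⟩ := hp hpS
    exact ⟨⟨h1, (hle p.1).trans h3⟩, h2⟩
  have hup : (μ₁.prod μ₂).withDensity f S ≤ (∫⁻ ω in M₁, g ω ∂μ₁) * H := by
    refine hST.trans ?_
    rw [withDensity_apply _ (hTm.prod hM₂)]
    calc ∫⁻ p in T ×ˢ M₂, f p ∂(μ₁.prod μ₂)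
        ≤ ∫⁻ p in T ×ˢ M₂, f₁ p.1 * h p.2 ∂(μ₁.prod μ₂) := by
          refine lintegral_mono_ae ((ae_restrict_iff' (hTm.prod hM₂)).2 ?_)
          filter_upwards [hf] with p hp hpm
          rw [hp hpm.2]
      _ = ∫⁻ p, f₁ p.1 * h p.2 ∂((μ₁.restrict T).prod (μ₂.restrict M₂)) := by
          rw [Measure.prod_restrict]
      _ ≤ ∫⁻ ω in T, ∫⁻ η in M₂, f₁ ω * h η ∂μ₂ ∂μ₁ := lintegral_prod_le _
      _ = ∫⁻ ω in T, f₁ ω * H ∂μ₁ := by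
          simp_rw [lintegral_const_mul' _ _ (hf₁ _), hH]
      _ = (∫⁻ ω in T, f₁' ω ∂μ₁) * H := by
          rw [lintegral_mul_const' _ _ hHtop, hint]
      _ ≤ (∫⁻ ω in T, g ω ∂μ₁) * H := by
          gcongr ?_ * _
          exact setLIntegral_mono' hTm fun ω hω => hω.2
      _ ≤ _ := by
          gcongr ?_ * _
          exact lintegral_mono_set inter_subset_left
  calc _ ≤ (∫⁻ ω in M₁, g ω ∂μ₁) * H * (μ₁ {ω₀} * c) := by gcongr
    _ = (∫⁻ ω in M₁, g ω ∂μ₁) * (μ₁ {ω₀} * c * H) := by ring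
    _ ≤ _ := by gcongr

theorem withDensity_eq_map_symm {Ω Ω' : Type*} [MeasurableSpace Ω] [MeasurableSpace Ω']
    {μ : Measure Ω} {ν : Measure Ω'} (E : Ω ≃ᵐ Ω') (hE : MeasurePreserving E μ ν)
    (f : Ω → ℝ≥0∞) (S : Set Ω) :
    μ.withDensity f S = ν.withDensity (fun p => f (E.symm p)) (E.symm ⁻¹' S) := by
  rw [← E.symm.map_apply]
  congr 1
  ext A hA
  rw [E.symm.map_apply, withDensity_apply _ hA, withDensity_apply _ (E.symm.measurable hA),
    ← hE.setLIntegral_comp_preimage_emb E.measurableEmbedding]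
  simp [← preimage_comp]

end Density

/-! ### Bridges and open edges -/

section Bridges

variable {V : Type*} {G : SimpleGraph V}

theorem mem_bridges_iff {β : ℝ} {ω : EdgeConfig G} {a b : V} {t : AddCircle β} :
    (s(a, b), t) ∈ bridges β ω ↔ ∃ h : s(a, b) ∈ G.edgeSet,
      ∃ i : Fin (ω ⟨s(a, b), h⟩).1, t = (((ω ⟨s(a, b), h⟩).2 i : ℝ) : AddCircle β) := by
  constructor
  · rintro ⟨⟨e, he⟩, i, hb⟩
    rw [Prod.mk.injEq] at hb
    obtain ⟨rfl, ht⟩ := hb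
    exact ⟨he, i, ht⟩
  · rintro ⟨h, i, rfl⟩
    exact ⟨⟨_, h⟩, i, rfl⟩

theorem mem_bridges_congr {β : ℝ} {ω ω' : EdgeConfig G} {a b : V} {t : AddCircle β}
    (h : ∀ h : s(a, b) ∈ G.edgeSet, ω ⟨s(a, b), h⟩ = ω' ⟨s(a, b), h⟩) :
    (s(a, b), t) ∈ bridges β ω ↔ (s(a, b), t) ∈ bridges β ω' := by
  rw [mem_bridges_iff, mem_bridges_iff]
  exact exists_congr fun he => by rw [h he]

theorem notMem_bridges {β : ℝ} {ω : EdgeConfig G} {a b : V} {t : AddCircle β}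
    (h : ∀ h : s(a, b) ∈ G.edgeSet, (ω ⟨s(a, b), h⟩).1 = 0) : (s(a, b), t) ∉ bridges β ω := by
  rw [mem_bridges_iff]
  rintro ⟨he, i, -⟩
  exact (Nat.not_lt_zero _ (h he ▸ i.2 : i.1 < 0))

open Classical in
/-- The set of edges that carry a bridge. -/
noncomputable def openEdges [Fintype V] (ω : EdgeConfig G) : Finset (Sym2 V) :=
  {e | ∃ h : e ∈ G.edgeSet, (ω ⟨e, h⟩).1 ≠ 0}

theorem mem_openEdges [Fintype V] {ω : EdgeConfig G} {e : Sym2 V} :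
    e ∈ openEdges ω ↔ ∃ h : e ∈ G.edgeSet, (ω ⟨e, h⟩).1 ≠ 0 := by
  simp [openEdges]

theorem mem_openEdges_of_bridge [Fintype V] {β : ℝ} {ω : EdgeConfig G} {a b : V} {t : AddCircle β}
    (h : (s(a, b), t) ∈ bridges β ω) : s(a, b) ∈ openEdges ω := by
  obtain ⟨he, i, -⟩ := mem_bridges_iff.1 h
  exact mem_openEdges.2 ⟨he, fun h0 => Nat.not_lt_zero _ (h0 ▸ i.2 : i.1 < 0)⟩

end Bridges

/-! ### Splitting off the edges of a cluster -/

section Split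

variable {V : Type*} [DecidableEq V] {G : SimpleGraph V}

/-- The separation of a configuration into its parts on the edges of `F` and on the other edges. -/
def splitEquiv (G : SimpleGraph V) (F : Finset (Sym2 V)) :
    EdgeConfig G ≃ᵐ ({e : G.edgeSet // (e : Sym2 V) ∈ F} → TimeList) ×
      ({e : G.edgeSet // (e : Sym2 V) ∉ F} → TimeList) :=
  MeasurableEquiv.piEquivPiSubtypeProd (fun _ : G.edgeSet => TimeList) fun e => (e : Sym2 V) ∈ F

theorem splitEquiv_symm_of_mem {F : Finset (Sym2 V)} (p) {e : G.edgeSet} (he : (e : Sym2 V) ∈ F) :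
    (splitEquiv G F).symm p e = p.1 ⟨e, he⟩ := by
  conv_rhs => rw [← (splitEquiv G F).apply_symm_apply p]
  rfl

theorem splitEquiv_symm_of_notMem {F : Finset (Sym2 V)} (p) {e : G.edgeSet}
    (he : (e : Sym2 V) ∉ F) : (splitEquiv G F).symm p e = p.2 ⟨e, he⟩ := by
  conv_rhs => rw [← (splitEquiv G F).apply_symm_apply p]
  rfl

theorem measurePreserving_splitEquiv [Fintype V] [DecidableRel G.Adj] {β : ℝ} (hβ : 0 < β)
    (F : Finset (Sym2 V)) :
    MeasurePreserving (splitEquiv G F) (poissonEdge G β)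
      ((Measure.pi fun _ => poissonTimes β).prod (Measure.pi fun _ => poissonTimes β)) := by
  have := isProbabilityMeasure_poissonTimes hβ
  exact measurePreserving_piEquivPiSubtypeProd (fun _ : G.edgeSet => poissonTimes β) _

end Split

/-! ### The weight of a cluster -/

section Weight

variable {V : Type*} {G : SimpleGraph V}

/-- Bounds that control the number of trajectories above a set of vertices `W`, in comparison with
the number `|W|` of trajectories in the absence of bridges: each bridge at `W` costs a factor `q`, and
each vertex of `W` but one costs a factor `c`. -/
structure IsControlled (G : SimpleGraph V) (σ : V → ℝ) (β ϑ q c : ℝ) : Prop where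
  finite : ∀ ω : EdgeConfig G, IsMatched (bridges β ω) →
    (trajectorySupports σ (bridges β ω)).Finite
  weight : ∀ ω : EdgeConfig G, IsMatched (bridges β ω) → ∀ (W : Finset V) (F : Finset G.edgeSet),
    (∀ e, (ω e).1 ≠ 0 → (∃ a ∈ (e : Sym2 V), a ∈ W) → e ∈ F) →
    (supportsAbove σ (bridges β ω) (W : Set V)).Nonempty →
    ϑ ^ (supportsAbove σ (bridges β ω) (W : Set V)).ncard ≤
      ϑ ^ W.card * c ^ (W.card - 1) * ∏ e ∈ F, q ^ (ω e).1

/-- Each cycle above `W` passes through `(v, 0)` for some `v ∈ W`. -/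
theorem cycle_count {β : ℝ} (hβ : 0 < β) {ω : EdgeConfig G} (hω : IsMatched (bridges β ω))
    (W : Finset V) :
    (supportsAbove cycleVelocity (bridges β ω) (W : Set V)).Finite ∧
      (supportsAbove cycleVelocity (bridges β ω) (W : Set V)).ncard ≤ W.card := by
  classical
  have h := ncard_supportsAbove_le (σ := cycleVelocity) hω (W := (W : Set V))
    (M := (W.image fun v => ((v, 0) : V × AddCircle β) : Finset _)) (Finset.finite_toSet _) ?_
  · refine ⟨h.1, h.2.trans ?_⟩
    rw [ncard_coe_finset]
    exact Finset.card_image_le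
  · rintro S ⟨hS, hSW⟩
    obtain ⟨p, hp, hp0⟩ := exists_mem_time_zero hβ hS
    refine ⟨p, ?_, hp⟩
    rw [Finset.mem_coe, Finset.mem_image]
    exact ⟨p.1, hSW hp, Prod.ext rfl hp0.symm⟩

/-- Each loop above `W` passes through `(v, 0)` for some `v ∈ W`, or arrives in the upward direction at
some bridge on an edge of `F`; each edge has only one endpoint with upward motion. -/
theorem loop_count {β : ℝ} (hβ : 0 < β) (A : G.Coloring Bool) {ω : EdgeConfig G}
    (hω : IsMatched (bridges β ω)) (W : Finset V) (F : Finset G.edgeSet)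
    (hF : ∀ e, (ω e).1 ≠ 0 → (∃ a ∈ (e : Sym2 V), a ∈ W) → e ∈ F) :
    (supportsAbove (loopVelocity A) (bridges β ω) (W : Set V)).Finite ∧
      (supportsAbove (loopVelocity A) (bridges β ω) (W : Set V)).ncard ≤
        W.card + ∑ e ∈ F, (ω e).1 := by
  classical
  have hend : ∀ e : G.edgeSet, ∃ v, ∀ a ∈ (e : Sym2 V), loopVelocity A a = 1 → a = v := by
    rintro ⟨e, he⟩
    induction e using Sym2.ind with
    | _ a b =>
      have hab : A a ≠ A b := A.valid he
      by_cases ha : A a = true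
      · refine ⟨a, fun y hy hy1 => ?_⟩
        rcases Sym2.mem_iff.1 hy with rfl | rfl
        · rfl
        · have : A y = false := by cases h : A y <;> simp_all
          norm_num [loopVelocity, this] at hy1
      · refine ⟨b, fun y hy hy1 => ?_⟩
        rcases Sym2.mem_iff.1 hy with rfl | rfl
        · norm_num [loopVelocity, ha] at hy1
        · rfl
  choose up hup using hend
  have hσ : ∀ v, loopVelocity A v = 1 ∨ loopVelocity A v = -1 := fun v => by
    unfold loopVelocity; split_ifs <;> simp
  have hσB : ∀ a b t, (s(a, b), t) ∈ bridges β ω → loopVelocity A b = -loopVelocity A a := by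
    intro a b t h
    obtain ⟨he, -⟩ := mem_bridges_iff.1 h
    have hab : A a ≠ A b := A.valid he
    unfold loopVelocity
    cases h1 : A a <;> cases h2 : A b <;> simp_all
  set M : Finset (V × AddCircle β) := (W.image fun v => (v, 0)) ∪ F.biUnion fun e =>
    Finset.univ.image fun i : Fin (ω e).1 => (up e, (((ω e).2 i : ℝ) : AddCircle β)) with hM
  have h := ncard_supportsAbove_le (σ := loopVelocity A) hω (W := (W : Set V))
    (M := (M : Set (V × AddCircle β))) (Finset.finite_toSet _) ?_
  · refine ⟨h.1, h.2.trans ?_⟩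
    rw [ncard_coe_finset]
    refine (Finset.card_union_le _ _).trans (add_le_add Finset.card_image_le ?_)
    refine Finset.card_biUnion_le.trans (Finset.sum_le_sum fun e _ => ?_)
    exact Finset.card_image_le.trans_eq (by simp)
  · rintro S ⟨hS, hSW⟩
    obtain ⟨⟨v, t⟩, hp, hp'⟩ := exists_mem_time_zero_or_bridge hβ hσ hσB hS
    refine ⟨_, ?_, hp⟩
    have hv : v ∈ W := hSW hp
    simp only [hM, Finset.coe_union, mem_union, Finset.mem_coe]
    rcases hp' with hp' | ⟨hv1, z, hz⟩
    · exact Or.inl (Finset.mem_image.2 ⟨v, hv, Prod.ext rfl hp'.symm⟩)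
    · have hz' : (s(v, z), t) ∈ bridges β ω := hz
      obtain ⟨he, i, rfl⟩ := mem_bridges_iff.1 hz'
      refine Or.inr (Finset.mem_biUnion.2 ⟨⟨_, he⟩, hF _ ?_ ⟨v, by simp, hv⟩,
        Finset.mem_image.2 ⟨i, Finset.mem_univ _, ?_⟩⟩)
      · exact fun h0 => Nat.not_lt_zero _ (h0 ▸ i.2 : i.1 < 0)
      · rw [← hup ⟨_, he⟩ v (by simp) hv1]

/-- For `ϑ ≤ 1`, it suffices that there is at least one trajectory above `W`. -/
theorem pow_ncard_le_of_le_one {σ : V → ℝ} {β ϑ : ℝ} (hϑ : 0 < ϑ) (hϑ1 : ϑ ≤ 1)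
    {B : Set (Sym2 V × AddCircle β)} {W : Finset V}
    (hfin : (supportsAbove σ B (W : Set V)).Finite)
    (hne : (supportsAbove σ B (W : Set V)).Nonempty) :
    ϑ ^ (supportsAbove σ B (W : Set V)).ncard ≤ ϑ ^ W.card * ϑ⁻¹ ^ (W.card - 1) := by
  have h1 : 1 ≤ (supportsAbove σ B (W : Set V)).ncard := (ncard_pos hfin).2 hne
  have hW : 1 ≤ W.card := by
    obtain ⟨S, hS, hSW⟩ := hne
    obtain ⟨p, hp⟩ := nonempty_of_mem_trajectorySupports hS
    exact Finset.card_pos.2 ⟨p.1, hSW hp⟩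
  calc _ ≤ ϑ ^ 1 := pow_le_pow_of_le_one hϑ.le hϑ1 h1
    _ = _ := by
      obtain ⟨m, hm⟩ := Nat.exists_eq_add_of_le' hW
      rw [hm, Nat.add_sub_cancel, pow_succ ϑ m, mul_right_comm, ← mul_pow, mul_inv_cancel₀ hϑ.ne']
      simp

variable [Fintype V]

theorem isControlled_cycles_of_le_one (G : SimpleGraph V) {β ϑ : ℝ} (hβ : 0 < β) (hϑ : 0 < ϑ)
    (hϑ1 : ϑ ≤ 1) : IsControlled G cycleVelocity β ϑ 1 ϑ⁻¹ where
  finite ω hω := by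
    have := (cycle_count hβ hω Finset.univ).1
    rwa [Finset.coe_univ, supportsAbove_univ] at this
  weight ω hω W F _ hne := by
    simpa using pow_ncard_le_of_le_one hϑ hϑ1 (cycle_count hβ hω W).1 hne

theorem isControlled_cycles_of_one_le (G : SimpleGraph V) {β ϑ : ℝ} (hβ : 0 < β) (hϑ1 : 1 ≤ ϑ) :
    IsControlled G cycleVelocity β ϑ 1 1 where
  finite ω hω := by
    have := (cycle_count hβ hω Finset.univ).1
    rwa [Finset.coe_univ, supportsAbove_univ] at this
  weight ω hω W F _ _ := by
    simpa using pow_le_pow_right₀ hϑ1 (cycle_count hβ hω W).2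

variable [DecidableRel G.Adj]

theorem finite_loops {β : ℝ} (hβ : 0 < β) (A : G.Coloring Bool) {ω : EdgeConfig G}
    (hω : IsMatched (bridges β ω)) :
    (trajectorySupports (loopVelocity A) (bridges β ω)).Finite := by
  have := (loop_count hβ A hω Finset.univ Finset.univ (by simp)).1
  rwa [Finset.coe_univ, supportsAbove_univ] at this

theorem isControlled_loops_of_le_one {β ϑ : ℝ} (hβ : 0 < β) (hϑ : 0 < ϑ)
    (hϑ1 : ϑ ≤ 1) (A : G.Coloring Bool) : IsControlled G (loopVelocity A) β ϑ 1 ϑ⁻¹ where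
  finite ω hω := finite_loops hβ A hω
  weight ω hω W F _ hne := by
    simpa using pow_ncard_le_of_le_one hϑ hϑ1
      ((finite_loops hβ A hω).subset fun _ hS => hS.1) hne

theorem isControlled_loops_of_one_le {β ϑ : ℝ} (hβ : 0 < β) (hϑ1 : 1 ≤ ϑ)
    (A : G.Coloring Bool) : IsControlled G (loopVelocity A) β ϑ ϑ 1 where
  finite ω hω := finite_loops hβ A hω
  weight ω hω W F hF _ := by
    rw [one_pow, mul_one, Finset.prod_pow_eq_pow_sum, ← pow_add]
    exact pow_le_pow_right₀ hϑ1 (loop_count hβ A hω W F hF).2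

/-! ### The normalization -/

variable [DecidableEq V]

theorem lintegral_weight_ne_top {σ : V → ℝ} {β ϑ q c : ℝ} (hβ : 0 < β) (hq : 1 ≤ q)
    (hc : IsControlled G σ β ϑ q c) :
    ∫⁻ ω, ENNReal.ofReal (ϑ ^ (trajectorySupports σ (bridges β ω)).ncard) ∂(poissonEdge G β) ≠
      ∞ := by
  have := isProbabilityMeasure_poissonTimes hβ
  set K : ℝ := max 1 (ϑ ^ Fintype.card V * c ^ (Fintype.card V - 1))
  have hbound : ∀ᵐ ω ∂(poissonEdge G β),
      ENNReal.ofReal (ϑ ^ (trajectorySupports σ (bridges β ω)).ncard) ≤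
        ENNReal.ofReal K * ∏ e, ENNReal.ofReal q ^ (ω e).1 := by
    filter_upwards [ae_isMatched G hβ] with ω hω
    have hprod : 1 ≤ ∏ e : G.edgeSet, q ^ (ω e).1 :=
      Finset.one_le_prod fun e _ => one_le_pow₀ hq
    have hK : (1 : ℝ) ≤ K := le_max_left _ _
    simp_rw [← ENNReal.ofReal_pow (zero_le_one.trans hq)]
    rw [← ENNReal.ofReal_prod_of_nonneg fun e _ => by positivity,
      ← ENNReal.ofReal_mul (by positivity)]
    refine ENNReal.ofReal_le_ofReal ?_
    rcases (trajectorySupports σ (bridges β ω)).eq_empty_or_nonempty with h0 | hne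
    · rw [h0, ncard_empty, pow_zero]
      exact one_le_mul_of_one_le_of_one_le hK hprod
    · have h := hc.weight ω hω Finset.univ Finset.univ (by simp)
      rw [Finset.coe_univ, supportsAbove_univ] at h
      refine (h hne).trans (mul_le_mul_of_nonneg_right ?_ (by positivity))
      exact le_max_right _ _
  refine ne_top_of_le_ne_top ?_ (lintegral_mono_ae hbound)
  have hm : Measurable fun t : TimeList => ENNReal.ofReal q ^ t.1 :=
    (measurable_of_countable fun n : ℕ => ENNReal.ofReal q ^ n).comp measurable_timeList_fst
  rw [lintegral_const_mul' _ _ ENNReal.ofReal_ne_top, poissonEdge, lintegral_pi_prod _ hm,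
    lintegral_poissonTimes_pow hβ (zero_le_one.trans hq)]
  exact ENNReal.mul_ne_top ENNReal.ofReal_ne_top (ENNReal.pow_ne_top ENNReal.ofReal_ne_top)

theorem pi_poissonTimes_noTimes {ι : Type*} [Fintype ι] {β : ℝ} (hβ : 0 < β) :
    (Measure.pi fun _ : ι => poissonTimes β) {fun _ => noTimes} =
      ENNReal.ofReal (Real.exp (-β)) ^ Fintype.card ι := by
  have := isProbabilityMeasure_poissonTimes hβ
  rw [Measure.pi_singleton]
  simp [poissonTimes_noTimes hβ]

theorem measurableSet_const_noTimes {ι : Type*} [Finite ι] :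
    MeasurableSet ({fun _ => noTimes} : Set (ι → TimeList)) := by
  have : ({fun _ => noTimes} : Set (ι → TimeList)) = {t | ∀ i, (t i).1 = 0} := by
    ext t
    simp [funext_iff, eq_noTimes_iff]
  rw [this, ofPred_forall]
  exact MeasurableSet.iInter fun i => measurableSet_fst_eq_zero.preimage (measurable_pi_apply i)

theorem lintegral_weight_ne_zero (G : SimpleGraph V) [DecidableRel G.Adj] (σ : V → ℝ) {β ϑ : ℝ}
    (hβ : 0 < β) (hϑ : 0 < ϑ) :
    ∫⁻ ω, ENNReal.ofReal (ϑ ^ (trajectorySupports σ (bridges β ω)).ncard) ∂(poissonEdge G β) ≠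
      0 := by
  -- the configuration without bridges has positive mass
  intro h0
  set ω₀ : EdgeConfig G := fun _ => noTimes
  have h := setLIntegral_le_lintegral (μ := poissonEdge G β) {ω₀} fun ω =>
    ENNReal.ofReal (ϑ ^ (trajectorySupports σ (bridges β ω)).ncard)
  rw [h0, setLIntegral_congr_fun (g := fun _ =>
    ENNReal.ofReal (ϑ ^ (trajectorySupports σ (bridges β ω₀)).ncard)) measurableSet_const_noTimes
    (fun ω hω => by rw [mem_singleton_iff.1 hω]), setLIntegral_const, poissonEdge,
    pi_poissonTimes_noTimes hβ] at h
  have : 0 < ENNReal.ofReal (ϑ ^ (trajectorySupports σ (bridges β ω₀)).ncard) *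
      ENNReal.ofReal (Real.exp (-β)) ^ Fintype.card G.edgeSet :=
    ENNReal.mul_pos (by simp; positivity) (pow_ne_zero _ (by simp; positivity))
  exact absurd h (not_le.2 this)

theorem isProbabilityMeasure_weightedMeasure {σ : V → ℝ} {β ϑ q c : ℝ} (hβ : 0 < β) (hϑ : 0 < ϑ)
    (hq : 1 ≤ q) (hc : IsControlled G σ β ϑ q c) :
    IsProbabilityMeasure (weightedMeasure G σ β ϑ) := by
  refine ⟨?_⟩
  rw [weightedMeasure, Measure.smul_apply, withDensity_apply _ MeasurableSet.univ,
    Measure.restrict_univ, smul_eq_mul]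
  exact ENNReal.inv_mul_cancel (lintegral_weight_ne_zero G σ hβ hϑ)
    (lintegral_weight_ne_top hβ hq hc)

end Weight

/-! ### The mass of a cluster -/

section Mass

variable {V : Type*} [Fintype V] [DecidableEq V] {G : SimpleGraph V}

open Classical in
/-- The open edges that are connected to `x`. -/
noncomputable def clusterEdges (x : V) (ω : EdgeConfig G) : Finset (Sym2 V) :=
  {e ∈ openEdges ω | ∃ a ∈ e, a ∈ cluster {x} (openEdges ω)}

theorem cluster_clusterEdges (x : V) (ω : EdgeConfig G) :
    cluster {x} (clusterEdges x ω) = cluster {x} (openEdges ω) := by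
  classical
  exact cluster_filter {x} (openEdges ω)

theorem isClusterSet_clusterEdges (x : V) (ω : EdgeConfig G) :
    IsClusterSet {x} (clusterEdges x ω) := by
  classical
  exact isClusterSet_filter {x} (openEdges ω)

theorem mem_cluster_iff_of_bridge {β : ℝ} {ω : EdgeConfig G} {x a b : V} {t : AddCircle β}
    (h : (s(a, b), t) ∈ bridges β ω) :
    a ∈ cluster {x} (openEdges ω) ↔ b ∈ cluster {x} (openEdges ω) := by
  have h' := mem_openEdges_of_bridge h
  exact ⟨cluster_closed h', cluster_closed (by rwa [Sym2.eq_swap])⟩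

variable [DecidableRel G.Adj]

/-- The weighted mass of the event that `F` is the cluster of `x` and that there is a trajectory above
its set of vertices, relative to the total mass: the bridges on `F` are compared with the absence of
bridges on `F`. -/
theorem withDensity_clusterEdges_le {σ : V → ℝ} {β ϑ q c : ℝ} (hβ : 0 < β) (hϑ : 0 < ϑ)
    (hq : 1 ≤ q) (hc0 : 0 ≤ c) (hσ : ∀ v, σ v = 1 ∨ σ v = -1) (hc : IsControlled G σ β ϑ q c)
    (x : V) {F : Finset (Sym2 V)} (hFG : F ⊆ G.edgeFinset) (hF : IsClusterSet {x} F) :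
    (poissonEdge G β).withDensity
        (fun ω => ENNReal.ofReal (ϑ ^ (trajectorySupports σ (bridges β ω)).ncard))
        {ω | clusterEdges x ω = F ∧
          (supportsAbove σ (bridges β ω) (cluster {x} F : Set V)).Nonempty} ≤
      ENNReal.ofReal ((Real.exp (β * q) - 1) ^ F.card * c ^ ((cluster {x} F).card - 1)) *
        ∫⁻ ω, ENNReal.ofReal (ϑ ^ (trajectorySupports σ (bridges β ω)).ncard)
          ∂(poissonEdge G β) := by
  classical
  have := isProbabilityMeasure_poissonTimes hβ
  set W : Finset V := cluster {x} F with hWdef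
  set ρ := poissonEdge G β with hρ
  set f : EdgeConfig G → ℝ≥0∞ := fun ω =>
    ENNReal.ofReal (ϑ ^ (trajectorySupports σ (bridges β ω)).ncard) with hfdef
  set E := splitEquiv G F with hE
  have hEmp := measurePreserving_splitEquiv (G := G) hβ F
  rw [← hE, ← hρ] at hEmp
  set μ₁ := Measure.pi fun _ : {e : G.edgeSet // (e : Sym2 V) ∈ F} => poissonTimes β
  set μ₂ := Measure.pi fun _ : {e : G.edgeSet // (e : Sym2 V) ∉ F} => poissonTimes β
  set η₁ : {e : G.edgeSet // (e : Sym2 V) ∈ F} → TimeList := fun _ => noTimes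
  set η₂ : {e : G.edgeSet // (e : Sym2 V) ∉ F} → TimeList := fun _ => noTimes
  set M₁ : Set ({e : G.edgeSet // (e : Sym2 V) ∈ F} → TimeList) := {t | ∀ e, (t e).1 ≠ 0} with hM₁
  set M₂ : Set ({e : G.edgeSet // (e : Sym2 V) ∉ F} → TimeList) :=
    {t | ∀ e, (∃ a ∈ (e.1 : Sym2 V), a ∈ W) → (t e).1 = 0} with hM₂
  set f₁ : ({e : G.edgeSet // (e : Sym2 V) ∈ F} → TimeList) → ℝ≥0∞ := fun t =>
    ENNReal.ofReal (ϑ ^ (supportsAbove σ (bridges β (E.symm (t, η₂))) (W : Set V)).ncard) with hf₁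
  set h : ({e : G.edgeSet // (e : Sym2 V) ∉ F} → TimeList) → ℝ≥0∞ := fun t =>
    ENNReal.ofReal (ϑ ^ (supportsAbove σ (bridges β (E.symm (η₁, t))) (W : Set V)ᶜ).ncard) with hh
  set C : ℝ := ϑ ^ W.card * c ^ (W.card - 1) with hC
  set g : ({e : G.edgeSet // (e : Sym2 V) ∈ F} → TimeList) → ℝ≥0∞ := fun t =>
    ENNReal.ofReal C * ∏ e, ENNReal.ofReal q ^ (t e).1 with hg
  have hC0 : 0 ≤ C := by positivity
  have hq0 : 0 ≤ q := zero_le_one.trans hq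
  -- no bridge connects `W` with its complement
  have hclosed : ∀ p : _ × _, p.2 ∈ M₂ → ∀ a b t, (s(a, b), t) ∈ bridges β (E.symm p) →
      (a ∈ (W : Set V) ↔ b ∈ (W : Set V)) := by
    intro p hp a b t hab
    by_cases hF' : s(a, b) ∈ F
    · exact ⟨cluster_closed hF', cluster_closed (by rwa [Sym2.eq_swap])⟩
    · have key : ¬ ∃ y ∈ s(a, b), y ∈ W := by
        intro hy
        refine notMem_bridges (fun he => ?_) hab
        rw [hE, splitEquiv_symm_of_notMem p hF']
        exact hp ⟨⟨_, he⟩, hF'⟩ hy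
      push Not at key
      exact ⟨fun ha => absurd ha (key a (by simp)), fun hb => absurd hb (key b (by simp))⟩
  -- above `W`, only the bridges on `F` are visible
  have hin : ∀ p : _ × _, p.2 ∈ M₂ → supportsAbove σ (bridges β (E.symm p)) (W : Set V) =
      supportsAbove σ (bridges β (E.symm (p.1, η₂))) (W : Set V) := by
    intro p hp
    refine supportsAbove_congr fun a b t ha => mem_bridges_congr fun he => ?_
    by_cases hF' : s(a, b) ∈ F
    · rw [hE, splitEquiv_symm_of_mem p hF', splitEquiv_symm_of_mem (p.1, η₂) hF']
    · rw [hE, splitEquiv_symm_of_notMem p hF', splitEquiv_symm_of_notMem (p.1, η₂) hF']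
      exact eq_noTimes_iff.2 (hp ⟨⟨_, he⟩, hF'⟩ ⟨a, by simp, ha⟩)
  -- above the complement of `W`, only the bridges outside `F` are visible
  have hout : ∀ p : _ × _, supportsAbove σ (bridges β (E.symm p)) (W : Set V)ᶜ =
      supportsAbove σ (bridges β (E.symm (η₁, p.2))) (W : Set V)ᶜ := by
    intro p
    refine supportsAbove_congr fun a b t ha => mem_bridges_congr fun he => ?_
    have hF' : s(a, b) ∉ F := by
      intro hab
      obtain ⟨y, hy, hyW⟩ := hF _ hab
      rcases Sym2.mem_iff.1 hy with rfl | rfl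
      · exact ha hyW
      · exact ha (cluster_closed (by rwa [Sym2.eq_swap]) hyW)
    rw [hE, splitEquiv_symm_of_notMem p hF', splitEquiv_symm_of_notMem (η₁, p.2) hF']
  have hmatch : ∀ᵐ p ∂(μ₁.prod μ₂), IsMatched (bridges β (E.symm p)) := by
    have := (hEmp.symm E).quasiMeasurePreserving.ae (ae_isMatched G hβ)
    exact this
  have hfac : ∀ p : _ × _, IsMatched (bridges β (E.symm p)) → p.2 ∈ M₂ →
      f (E.symm p) = f₁ p.1 * h p.2 := by
    intro p hp hp2
    simp only [hfdef, hf₁, hh]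
    rw [ncard_trajectorySupports_eq_add (hclosed p hp2) (hc.finite _ hp), pow_add,
      ENNReal.ofReal_mul (by positivity), hin p hp2, hout p]
  have hf₁0 : f₁ η₁ = ENNReal.ofReal (ϑ ^ W.card) := by
    simp only [hf₁]
    rw [ncard_supportsAbove_of_no_bridge hβ hσ W fun v _ z t => notMem_bridges fun he => ?_]
    by_cases hF' : s(v, z) ∈ F
    · rw [hE, splitEquiv_symm_of_mem _ hF']; rfl
    · rw [hE, splitEquiv_symm_of_notMem _ hF']; rfl
  have hM₁m : MeasurableSet M₁ := by
    rw [hM₁, ofPred_forall]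
    exact MeasurableSet.iInter fun e =>
      measurableSet_fst_eq_zero.compl.preimage (measurable_pi_apply e)
  have hM₂m : MeasurableSet M₂ := by
    rw [hM₂, ofPred_forall]
    refine MeasurableSet.iInter fun e => ?_
    rw [ofPred_forall]
    exact MeasurableSet.iInter fun _ => measurableSet_fst_eq_zero.preimage (measurable_pi_apply e)
  have hgm : Measurable g := by
    refine Measurable.const_mul (Finset.measurable_prod _ fun e _ => ?_) _
    exact (measurable_of_countable fun n : ℕ => ENNReal.ofReal q ^ n).comp
      (measurable_timeList_fst.comp (measurable_pi_apply e))
  have hZeq : ∫⁻ ω, f ω ∂ρ = ∫⁻ p, f (E.symm p) ∂(μ₁.prod μ₂) := by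
    rw [← hEmp.lintegral_comp_emb E.measurableEmbedding]
    simp
  have hZtop := lintegral_weight_ne_top hβ hq hc
  have hcard : Fintype.card {e : G.edgeSet // (e : Sym2 V) ∈ F} = F.card := by
    rw [← Fintype.card_coe F]
    refine Fintype.card_congr ⟨fun e => ⟨e.1, e.2⟩, fun e => ⟨⟨e.1, ?_⟩, e.2⟩, fun _ => rfl,
      fun _ => rfl⟩
    simpa using hFG e.2
  have hmass : μ₁ {η₁} = ENNReal.ofReal (Real.exp (-β)) ^ F.card := by
    rw [← hcard]
    exact pi_poissonTimes_noTimes hβ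
  have hmass0 : μ₁ {η₁} ≠ 0 := by
    rw [hmass]
    exact pow_ne_zero _ (by simp; positivity)
  have hϑW0 : ENNReal.ofReal (ϑ ^ W.card) ≠ 0 := by simp; positivity
  have main := withDensity_prod_mul_le μ₁ μ₂ (f := fun p => f (E.symm p)) (f₁ := f₁) (g := g)
    (h := h) (c := ENNReal.ofReal (ϑ ^ W.card)) (ω₀ := η₁) (M₁ := M₁) (M₂ := M₂)
    (S := E.symm ⁻¹' {ω | clusterEdges x ω = F ∧
          (supportsAbove σ (bridges β ω) (W : Set V)).Nonempty})
    measurableSet_const_noTimes hM₁m hM₂m hgm (fun _ => ENNReal.ofReal_ne_top) hϑW0 hmass0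
    (hZeq ▸ hZtop) ?_ ?_ ?_
  · rw [withDensity_eq_map_symm E hEmp f, hZeq]
    have hint : ∫⁻ t in M₁, g t ∂μ₁ =
        ENNReal.ofReal ((Real.exp (β * q) - 1) ^ F.card * c ^ (W.card - 1)) *
          (μ₁ {η₁} * ENNReal.ofReal (ϑ ^ W.card)) := by
      have h1 : 0 ≤ Real.exp (β * q) - 1 := by
        have := Real.one_le_exp (show 0 ≤ β * q by positivity)
        linarith
      simp only [hg]
      rw [lintegral_const_mul' _ _ ENNReal.ofReal_ne_top, setLIntegral_pi_poissonTimes hβ hq0,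
        hcard, hmass, hC, ENNReal.ofReal_mul (by positivity), ENNReal.ofReal_mul (by positivity),
        ENNReal.ofReal_pow h1]
      ring
    rw [hint] at main
    have hne0 : μ₁ {η₁} * ENNReal.ofReal (ϑ ^ W.card) ≠ 0 := mul_ne_zero hmass0 hϑW0
    have hnetop : μ₁ {η₁} * ENNReal.ofReal (ϑ ^ W.card) ≠ ∞ :=
      ENNReal.mul_ne_top (measure_ne_top _ _) ENNReal.ofReal_ne_top
    rw [mul_right_comm] at main
    exact (ENNReal.mul_le_mul_iff_left hne0 hnetop).1 main
  · filter_upwards [hmatch] with p hp hp2 using hfac p hp hp2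
  · filter_upwards [hmatch] with p hp hp1 hp2
    rw [hfac p hp hp2, hp1, hf₁0]
  · filter_upwards [hmatch] with p hp hpS
    obtain ⟨hpF, hpne⟩ := hpS
    have hWo : cluster {x} (openEdges (E.symm p)) = W :=
      (cluster_clusterEdges x (E.symm p)).symm.trans (congrArg _ hpF)
    have hmemF : ∀ e : Sym2 V, e ∈ F ↔ e ∈ openEdges (E.symm p) ∧ ∃ a ∈ e, a ∈ W := by
      intro e
      have h := Finset.ext_iff.1 hpF e
      rw [clusterEdges, Finset.mem_filter, hWo] at h
      exact h.symm
    have hopen : ∀ e : G.edgeSet, (e : Sym2 V) ∈ F → (E.symm p e).1 ≠ 0 := fun e he =>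
      (mem_openEdges.1 ((hmemF _).1 he).1).2
    have htouch : ∀ e : G.edgeSet, (E.symm p e).1 ≠ 0 → (∃ a ∈ (e : Sym2 V), a ∈ W) →
        (e : Sym2 V) ∈ F := fun e he ha => (hmemF _).2 ⟨mem_openEdges.2 ⟨e.2, he⟩, ha⟩
    have hp1 : p.1 ∈ M₁ := fun e => by
      have := hopen e.1 e.2
      rwa [hE, splitEquiv_symm_of_mem p e.2] at this
    have hp2 : p.2 ∈ M₂ := fun e ha => by
      by_contra hne
      exact e.2 (htouch e.1 (by rwa [hE, splitEquiv_symm_of_notMem p e.2]) ha)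
    refine ⟨hp1, hp2, ?_⟩
    have hw := hc.weight (E.symm p) hp W ({e | (e : Sym2 V) ∈ F} : Finset G.edgeSet)
      (fun e he ha => Finset.mem_filter.2 ⟨Finset.mem_univ _, htouch e he ha⟩) hpne
    simp only [hf₁, hg]
    rw [← hin p hp2]
    refine (ENNReal.ofReal_le_ofReal hw).trans_eq ?_
    rw [ENNReal.ofReal_mul hC0, ENNReal.ofReal_prod_of_nonneg fun e _ => by positivity]
    congr 1
    rw [Finset.prod_subtype (p := fun e : G.edgeSet => (e : Sym2 V) ∈ F) _ (by simp)]
    refine Finset.prod_congr rfl fun e _ => ?_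
    rw [hE, splitEquiv_symm_of_mem p e.2, ENNReal.ofReal_pow hq0]

end Mass

/-! ### Decay of the length -/

section Decay

/-- The bound in terms of `φ = κ / (κ - 1)` and of `b = a κ φ ^ (κ - 1)`. -/
theorem decayBound_eq {a k : ℝ} {κ : ℕ} (hκ : 2 ≤ κ) (ha : 0 < a) {φ b : ℝ}
    (hφ : φ = κ / ((κ : ℝ) - 1)) (hb : b = a * κ * φ ^ (κ - 1)) :
    decayBound a κ k = φ ^ κ * b ^ (k - 1) := by
  have hκ' : (2 : ℝ) ≤ κ := by exact_mod_cast hκ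
  have h1 : (0 : ℝ) < (κ : ℝ) - 1 := by linarith
  have hφ0 : 0 < φ := by rw [hφ]; positivity
  have hb0 : 0 < b := by rw [hb]; positivity
  have hpow : (1 - 1 / (κ : ℝ)) ^ (-(κ : ℝ) + 1) = φ ^ (κ - 1) := by
    have : 1 - 1 / (κ : ℝ) = φ⁻¹ := by rw [hφ]; field_simp
    rw [this, Real.inv_rpow hφ0.le, ← Real.rpow_neg hφ0.le, ← Real.rpow_natCast,
      Nat.cast_sub (by omega)]
    congr 1
    push_cast
    ring
  have hfac : (a * ((κ : ℝ) - 1))⁻¹ * b = φ ^ κ := by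
    obtain ⟨m, rfl⟩ : ∃ m, κ = m + 1 := ⟨κ - 1, by omega⟩
    rw [hb, Nat.add_sub_cancel, pow_succ]
    nth_rewrite 3 [hφ]
    field_simp
  rw [decayBound, hpow, ← hb, ← hfac, mul_assoc, Real.rpow_sub_one hb0.ne', mul_div_cancel₀ _ hb0.ne']

/-- The generating function of the clusters of one vertex. -/
theorem sum_clusters_le {V : Type*} [Fintype V] [DecidableEq V] (G : SimpleGraph V)
    [DecidableRel G.Adj] {φ w z : ℝ} (hφ : 1 ≤ φ) (hw : 0 ≤ w) (hz : 0 ≤ z)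
    (h1 : 1 + w ≤ φ ^ 2) (h2 : 1 + w * z * φ ^ (G.maxDegree - 1) ≤ φ) (x : V)
    [DecidablePred (IsClusterSet ({x} : Finset V))] :
    ∑ F ∈ G.edgeFinset.powerset with IsClusterSet {x} F,
      w ^ F.card * z ^ ((cluster {x} F).card - 1) ≤ φ ^ G.maxDegree := by
  classical
  have hdeg : ∀ v, ({e ∈ G.edgeFinset | v ∈ e} : Finset _).card ≤ G.maxDegree := fun v => by
    rw [← G.incidenceFinset_eq_filter, G.card_incidenceFinset_eq_degree]
    exact G.degree_le_maxDegree v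
  have := sum_isClusterSet_le hφ hw hz h1 h2 _ G.edgeFinset rfl
    (fun e he => G.not_isDiag_of_mem_edgeFinset he) (fun v => by convert hdeg v) {x}
  rw [Finset.sum_filter]
  refine le_trans (le_of_eq ?_) (this.trans ?_)
  · refine Finset.sum_congr rfl fun F _ => ?_
    simp only [Finset.card_singleton]
  · rw [Finset.sum_singleton]
    exact pow_le_pow_right₀ hφ (by convert hdeg x)

/-- Long trajectories have large clusters. -/
theorem exists_of_lt_lengthAt {V : Type*} [Fintype V] [DecidableEq V] {G : SimpleGraph V}
    {σ : V → ℝ} {β k : ℝ} (hβ : 0 < β) (hk : 0 ≤ k) (hσ : ∀ v, σ v = 1 ∨ σ v = -1)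
    {ω : EdgeConfig G} (hω : IsMatched (bridges β ω)) {x : V}
    (h : β * k < lengthAt σ (bridges β ω) x) :
    k < (cluster {x} (openEdges ω)).card ∧
      (supportsAbove σ (bridges β ω) (cluster {x} (openEdges ω) : Set V)).Nonempty := by
  have hne : {L | ∃ γ : ℝ → V × AddCircle β, IsClosedTrajectory σ (bridges β ω) L γ ∧
      (x, (0 : AddCircle β)) ∈ γ '' Icc 0 L}.Nonempty := by
    by_contra hemp
    rw [not_nonempty_iff_eq_empty] at hemp
    rw [lengthAt, hemp, Real.sSup_empty] at h
    exact absurd h (not_lt.2 (by positivity))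
  obtain ⟨L, ⟨γ, hγ, hx⟩, hL⟩ := exists_lt_of_lt_csSup hne h
  have hxW : x ∈ cluster {x} (openEdges ω) := subset_cluster _ _ (by simp)
  have hlen := hγ.length_le hβ hσ hω (cluster {x} (openEdges ω))
    (fun a b t hab => (mem_cluster_iff_of_bridge hab).1) hx hxW
  refine ⟨lt_of_mul_lt_mul_left (hL.trans_le hlen) hβ.le, _, ⟨L, γ, hγ, rfl⟩, ?_⟩
  exact subset_of_mem_trajectorySupports (fun a b t hab => (mem_cluster_iff_of_bridge hab).1)
    ⟨L, γ, hγ, rfl⟩ hx hxW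

/-- The decay of the length, for any velocities whose trajectories are controlled by `q` and `c`. -/
theorem weightedMeasure_lengthAt_le {V : Type*} [Fintype V] [DecidableEq V] {G : SimpleGraph V}
    [DecidableRel G.Adj] (hκ : 2 ≤ G.maxDegree) {σ : V → ℝ} {β ϑ q c a : ℝ} (hβ : 0 < β)
    (hϑ : 0 < ϑ) (hq : 1 ≤ q) (hc1 : 1 ≤ c) (hσ : ∀ v, σ v = 1 ∨ σ v = -1)
    (hc : IsControlled G σ β ϑ q c) (ha : 1 - Real.exp (-β) ≤ a)
    (hac : (Real.exp (β * q) - 1) * c = a * Real.exp β) (x : V) {k : ℝ} (hk : 1 ≤ k) :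
    weightedMeasure G σ β ϑ {ω | β * k < lengthAt σ (bridges β ω) x} ≤
      ENNReal.ofReal (decayBound a G.maxDegree k) := by
  classical
  have hprob := isProbabilityMeasure_weightedMeasure hβ hϑ hq hc
  have ha0 : 0 < a := lt_of_lt_of_le (by simpa using hβ) ha
  set κ := G.maxDegree with hκdef
  have hκ' : (2 : ℝ) ≤ κ := by exact_mod_cast hκ
  have hκ1 : (0 : ℝ) < (κ : ℝ) - 1 := by linarith
  obtain ⟨φ, hφ⟩ : ∃ φ : ℝ, φ = κ / ((κ : ℝ) - 1) := ⟨_, rfl⟩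
  obtain ⟨b, hb⟩ : ∃ b : ℝ, b = a * κ * φ ^ (κ - 1) := ⟨_, rfl⟩
  have hφ1 : 1 ≤ φ := by rw [hφ, one_le_div hκ1]; linarith
  have hφ0 : 0 < φ := by linarith
  have hb0 : 0 < b := by rw [hb]; positivity
  have hφκ : φ / κ = φ - 1 := by rw [hφ]; field_simp; ring
  rw [decayBound_eq hκ ha0 hφ hb]
  -- for `1 ≤ b` the right side is at least `1`
  rcases le_or_gt 1 b with hb1 | hb1
  · refine prob_le_one.trans ?_
    rw [ENNReal.one_le_ofReal]
    exact one_le_mul_of_one_le_of_one_le (one_le_pow₀ hφ1)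
      (Real.one_le_rpow hb1 (by linarith))
  -- in the remaining case, `β` and `a` are small
  have haκ : a * κ ≤ 1 := by
    have : a * κ * 1 ≤ a * κ * φ ^ (κ - 1) :=
      mul_le_mul_of_nonneg_left (one_le_pow₀ hφ1) (by positivity)
    linarith
  have hexp : Real.exp β ≤ φ := by
    have h1 : 1 - a ≤ Real.exp (-β) := by linarith
    have h2 : φ⁻¹ ≤ 1 - a := by
      have : φ⁻¹ = 1 - 1 / κ := by rw [hφ]; field_simp
      rw [this]
      have : a ≤ 1 / κ := by rw [le_div_iff₀ (by linarith)]; exact haκ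
      linarith
    rw [Real.exp_neg] at h1
    exact (inv_le_inv₀ hφ0 (Real.exp_pos β)).1 (h2.trans h1)
  set w : ℝ := Real.exp (β * q) - 1 with hw
  have hw0 : 0 ≤ w := by
    have := Real.one_le_exp (show 0 ≤ β * q by positivity)
    rw [hw]; linarith
  have hwc : w * c ≤ a * φ := by
    rw [hac]; exact mul_le_mul_of_nonneg_left hexp ha0.le
  have hwφ : 1 + w ≤ φ ^ 2 := by
    have h1 : w ≤ w * c := le_mul_of_one_le_right hw0 hc1
    have h2 : a * φ ≤ φ / κ := by
      rw [le_div_iff₀ (by linarith)]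
      nlinarith
    rw [hφκ] at h2
    nlinarith
  have hwz : 1 + w * (c / b) * φ ^ (κ - 1) ≤ φ := by
    have h1 : w * (c / b) * φ ^ (κ - 1) = w * c / (a * κ) := by
      rw [hb]; field_simp
    have h2 : w * c / (a * κ) ≤ φ / κ := by
      rw [div_le_div_iff₀ (by positivity) (by linarith)]
      nlinarith
    rw [hφκ] at h2
    rw [h1]; linarith
  set I : Finset (Finset (Sym2 V)) :=
    {F ∈ G.edgeFinset.powerset | IsClusterSet {x} F ∧ k < (cluster {x} F).card} with hI
  set f : EdgeConfig G → ℝ≥0∞ := fun ω =>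
    ENNReal.ofReal (ϑ ^ (trajectorySupports σ (bridges β ω)).ncard) with hf
  set Z : ℝ≥0∞ := ∫⁻ ω, f ω ∂(poissonEdge G β) with hZ
  have hZ0 : Z ≠ 0 := lintegral_weight_ne_zero G σ hβ hϑ
  have hZtop : Z ≠ ∞ := lintegral_weight_ne_top hβ hq hc
  have hcover : (poissonEdge G β).withDensity f {ω | β * k < lengthAt σ (bridges β ω) x} ≤
      (poissonEdge G β).withDensity f (⋃ F ∈ I, {ω | clusterEdges x ω = F ∧
        (supportsAbove σ (bridges β ω) (cluster {x} F : Set V)).Nonempty}) := by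
    refine measure_mono_ae ?_
    filter_upwards [(withDensity_absolutelyContinuous (poissonEdge G β) f).ae_le
      (ae_isMatched G hβ)] with ω hω hlt
    obtain ⟨h1, h2⟩ := exists_of_lt_lengthAt hβ (by linarith) hσ hω hlt
    rw [← cluster_clusterEdges] at h1 h2
    refine mem_biUnion (show clusterEdges x ω ∈ I from ?_) ⟨rfl, h2⟩
    rw [hI, Finset.mem_filter, Finset.mem_powerset]
    refine ⟨fun e he => ?_, isClusterSet_clusterEdges x ω, h1⟩
    rw [clusterEdges, Finset.mem_filter, mem_openEdges] at he
    obtain ⟨⟨he, -⟩, -⟩ := he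
    simpa using he
  have hterm : ∀ F ∈ I, w ^ F.card * c ^ ((cluster {x} F).card - 1) ≤
      b ^ (k - 1) * (w ^ F.card * (c / b) ^ ((cluster {x} F).card - 1)) := by
    intro F hF
    have hlt := (Finset.mem_filter.1 hF).2.2
    set m := (cluster {x} F).card
    have hm : k - 1 ≤ ((m - 1 : ℕ) : ℝ) := by
      have hm1 : 1 ≤ m := by
        have : (0 : ℝ) < m := by linarith
        exact_mod_cast this
      rw [Nat.cast_sub hm1]
      push_cast
      linarith
    have h1 : b ^ (m - 1) ≤ b ^ (k - 1) := by
      rw [← Real.rpow_natCast]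
      exact Real.rpow_le_rpow_of_exponent_ge hb0 hb1.le hm
    rw [div_pow]
    calc w ^ F.card * c ^ (m - 1)
        = b ^ (m - 1) * (w ^ F.card * (c ^ (m - 1) / b ^ (m - 1))) := by
          field_simp
      _ ≤ _ := mul_le_mul_of_nonneg_right h1 (by positivity)
  have hsum : ∑ F ∈ I, w ^ F.card * c ^ ((cluster {x} F).card - 1) ≤ φ ^ κ * b ^ (k - 1) := by
    calc _ ≤ ∑ F ∈ I, b ^ (k - 1) * (w ^ F.card * (c / b) ^ ((cluster {x} F).card - 1)) :=
          Finset.sum_le_sum hterm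
      _ ≤ ∑ F ∈ G.edgeFinset.powerset with IsClusterSet {x} F,
            b ^ (k - 1) * (w ^ F.card * (c / b) ^ ((cluster {x} F).card - 1)) := by
          refine Finset.sum_le_sum_of_subset_of_nonneg (fun F hF => ?_) fun F _ _ => by positivity
          rw [hI, Finset.mem_filter] at hF
          exact Finset.mem_filter.2 ⟨hF.1, hF.2.1⟩
      _ = b ^ (k - 1) * ∑ F ∈ G.edgeFinset.powerset with IsClusterSet {x} F,
            w ^ F.card * (c / b) ^ ((cluster {x} F).card - 1) := by rw [Finset.mul_sum]
      _ ≤ b ^ (k - 1) * φ ^ κ := mul_le_mul_of_nonneg_left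
          (sum_clusters_le G hφ1 hw0 (by positivity) hwφ hwz x) (by positivity)
      _ = _ := mul_comm _ _
  rw [weightedMeasure, Measure.smul_apply, smul_eq_mul]
  calc Z⁻¹ * (poissonEdge G β).withDensity f {ω | β * k < lengthAt σ (bridges β ω) x}
      ≤ Z⁻¹ * ∑ F ∈ I, (poissonEdge G β).withDensity f {ω | clusterEdges x ω = F ∧
        (supportsAbove σ (bridges β ω) (cluster {x} F : Set V)).Nonempty} :=
        mul_le_mul_right (hcover.trans (measure_biUnion_finset_le _ _)) _
    _ ≤ Z⁻¹ * ∑ F ∈ I, ENNReal.ofReal (w ^ F.card * c ^ ((cluster {x} F).card - 1)) * Z := by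
        refine mul_le_mul_right (Finset.sum_le_sum fun F hF => ?_) _
        rw [hI, Finset.mem_filter, Finset.mem_powerset] at hF
        exact withDensity_clusterEdges_le hβ hϑ hq (zero_le_one.trans hc1) hσ hc x hF.1 hF.2.1
    _ = ENNReal.ofReal (∑ F ∈ I, w ^ F.card * c ^ ((cluster {x} F).card - 1)) := by
        rw [← Finset.sum_mul, ← ENNReal.ofReal_sum_of_nonneg fun F _ => by positivity,
          mul_comm _ Z, ← mul_assoc, ENNReal.inv_mul_cancel hZ0 hZtop, one_mul]
    _ ≤ _ := ENNReal.ofReal_le_ofReal hsum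

end Decay

theorem theoremt {V : Type*} [Fintype V] [DecidableEq V] (G : SimpleGraph V) [DecidableRel G.Adj]
    (hκ : 2 ≤ G.maxDegree) (β ϑ : ℝ) (hβ : 0 < β) (hϑ : 0 < ϑ) :
    (IsProbabilityMeasure (cycleMeasure G β ϑ) ∧
      ∀ (x : V) (k : ℝ), 1 ≤ k →
        cycleMeasure G β ϑ {ω | β * k < cycleLength β ω x} ≤
          ENNReal.ofReal (decayBound (aCycles β ϑ) G.maxDegree k)) ∧
    ∀ A : G.Coloring Bool,
      IsProbabilityMeasure (loopMeasure G A β ϑ) ∧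
        ∀ (x : V) (k : ℝ), 1 ≤ k →
          loopMeasure G A β ϑ {ω | β * k < loopLength A β ω x} ≤
            ENNReal.ofReal (decayBound (aLoops β ϑ) G.maxDegree k) := by
  have hcyc : ∀ v : V, cycleVelocity v = 1 ∨ cycleVelocity v = -1 := fun v => Or.inl rfl
  have hloop : ∀ (A : G.Coloring Bool) (v : V), loopVelocity A v = 1 ∨ loopVelocity A v = -1 :=
    fun A v => by unfold loopVelocity; split_ifs <;> simp
  have he : Real.exp (-β) * Real.exp β = 1 := by rw [← Real.exp_add]; simp
  have hsmall : 0 ≤ 1 - Real.exp (-β) := by simpa using hβ.le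
  rcases le_total ϑ 1 with h1 | h1
  · have hinv : 1 ≤ ϑ⁻¹ := (one_le_inv₀ hϑ).2 h1
    have ha : 1 - Real.exp (-β) ≤ ϑ⁻¹ * (1 - Real.exp (-β)) := le_mul_of_one_le_left hsmall hinv
    have hac : (Real.exp (β * 1) - 1) * ϑ⁻¹ = ϑ⁻¹ * (1 - Real.exp (-β)) * Real.exp β := by
      rw [mul_one]; linear_combination ϑ⁻¹ * he
    have hC := isControlled_cycles_of_le_one G hβ hϑ h1
    have hL := isControlled_loops_of_le_one (G := G) hβ hϑ h1
    rw [aCycles, aLoops, if_pos h1, if_pos h1]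
    exact ⟨⟨isProbabilityMeasure_weightedMeasure hβ hϑ le_rfl hC, fun x k hk =>
      weightedMeasure_lengthAt_le hκ hβ hϑ le_rfl hinv hcyc hC ha hac x hk⟩,
      fun A => ⟨isProbabilityMeasure_weightedMeasure hβ hϑ le_rfl (hL A), fun x k hk =>
      weightedMeasure_lengthAt_le hκ hβ hϑ le_rfl hinv (hloop A) (hL A) ha hac x hk⟩⟩
  · have hC := isControlled_cycles_of_one_le G hβ h1
    have hL := isControlled_loops_of_one_le (G := G) hβ h1
    have haC : aCycles β ϑ = 1 - Real.exp (-β) := by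
      unfold aCycles
      split_ifs with h
      · simp [le_antisymm h h1]
      · rfl
    have haL : aLoops β ϑ = Real.exp (-β) * (Real.exp (β * ϑ) - 1) := by
      unfold aLoops
      split_ifs with h
      · rw [le_antisymm h h1, mul_one]; linear_combination -he
      · rfl
    rw [haC, haL]
    refine ⟨⟨isProbabilityMeasure_weightedMeasure hβ hϑ le_rfl hC, fun x k hk =>
      weightedMeasure_lengthAt_le hκ hβ hϑ le_rfl le_rfl hcyc hC le_rfl ?_ x hk⟩,
      fun A => ⟨isProbabilityMeasure_weightedMeasure hβ hϑ h1 (hL A), fun x k hk =>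
      weightedMeasure_lengthAt_le hκ hβ hϑ h1 le_rfl (hloop A) (hL A) ?_ ?_ x hk⟩⟩
    · rw [mul_one, mul_one]; linear_combination he
    · have h2 : Real.exp β ≤ Real.exp (β * ϑ) :=
        Real.exp_le_exp.2 (le_mul_of_one_le_right hβ.le h1)
      nlinarith [Real.exp_pos (-β)]
    · linear_combination (1 - Real.exp (β * ϑ)) * he
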